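/- **Setting.** Let $P$ be the transition matrix of an ergodic (irreducible and aperiodic) time-homogeneous Markov chain on a finite set $\Omega$, with stationary distribution $\mu$. Put $d_{\mathrm{mix}}(t)=\sup_{z\in\Omega}\|P^t(z,\cdot)-\mu\|_{TV}$, where $\|p-q\|_{TV}=\sup_{A\subseteq\Omega}|p(A)-q(A)|$, and let $\tau_{\mathrm{mix}}=\min\{t\ge 1: d_{\mathrm{mix}}(t)\le 1/4\}$. Let $z_1,z_2,\dots$ be a Markov chain with transition matrix $P$ and arbitrary initial distribution, and let $J_1,J_2,\dots$ be i.i.d. with $\mathbb P(J_t=j)=2^{-j}$ for $j\ge 1$, independent of the chain. Let $\mathcal K\subseteq\mathbb R^d$ be nonempty, closed and convex, with $\|x-y\|\le D$ for all $x,y\in\mathcal K$ (Euclidean norm). For every $z\in\Omega$ let $f(\cdot;z)$ be differentiable on $\mathcal K$, with gradient satisfying $\|\nabla f(w;z)\|\le G$ for all $w\in\mathcal K$, where $G>0$. Assume that $F(w)=\mathbb E_{z\sim\mu}[f(w;z)]$ is convex on $\mathcal K$, and let $w^*$ be a minimizer of $F$ over $\mathcal K$. **Algorithm (MAG).** Given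 a number of iterations $T\ge1$, a scaling parameter $\alpha=D/\sqrt2$ and a starting point $w_1\in\mathcal K$, iteration $t=1,\dots,T$ uses the next $N_t$ samples $z_t^{(1)},\dots,z_t^{(N_t)}$ of the chain not used by earlier iterations, where $N_t=2^{J_t}$ if $2^{J_t}\le T$ and $N_t=1$ otherwise. With $g_t^j=2^{-j}\sum_{i=1}^{2^j}\nabla f(w_t;z_t^{(i)})$ it forms $$g_t=g_t^0+\begin{cases}2^{J_t}\,(g_t^{J_t}-g_t^{J_t-1}), & 2^{J_t}\le T,\\ 0,&\text{otherwise,}\end{cases}\qquad \eta_t=\frac{\alpha}{\sqrt{\sum_{k=1}^t\|g_k\|^2}},\qquad w_{t+1}=\Pi_{\mathcal K}(w_t-\eta_t g_t),$$ where $\Pi_{\mathcal K}$ is the Euclidean projection onto $\mathcal K$ and $\eta_tg_t=0$ if $g_1=\dots=g_t=0$. It returns $\bar w_T=\frac1T\sum_{t=1}^Tw_t$. In particular, the algorithm does not use $\tau_{\mathrm{mix}}$. **Theorem.** There are absolute constants $C>0$ and $p\in\mathbb N$ (independent of $d$, $\Omega$, the chain, $\mathcal K$, $f$, $G$, $D$,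 $w_1$ and $T$) such that in the above setting, for all $T\ge1$, $$\mathbb E[F(\bar w_T)-F(w^*)]\le C\,(1+\log T)^p\; GD\sqrt{\frac{\tau_{\mathrm{mix}}}{T}},$$ and the total number of samples used satisfies $$\mathbb E\Big[\sum_{t=1}^TN_t\Big]\le C\,T\,(1+\log T).$$ (Both random variables are integrable.) -/

import Mathlib

open MeasureTheory ProbabilityTheory

noncomputable section

namespace MAG

/-! ### Finite Markov chains and mixing times -/

section Chain

variable {Ω : Type*} [Fintype Ω]

/-- Total variation distance `sup_A |p(A) - q(A)|` of two mass functions on a finite set. -/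
def tvDist (p q : Ω → ℝ) : ℝ :=
  ⨆ A : Finset Ω, |∑ x ∈ A, p x - ∑ x ∈ A, q x|

variable [DecidableEq Ω]

/-- Every state has period one: the only common divisor of the return times
`{t ≥ 1 : P^t(x, x) > 0}` is `1`. -/
def IsAperiodic (P : Matrix Ω Ω ℝ) : Prop :=
  ∀ x : Ω, ∀ k : ℕ, (∀ t : ℕ, 1 ≤ t → 0 < (P ^ t) x x → k ∣ t) → k = 1

/-- Transition matrix of an ergodic (irreducible and aperiodic) finite Markov chain. -/
structure IsErgodic (P : Matrix Ω Ω ℝ) : Prop where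
  stochastic : P ∈ Matrix.rowStochastic ℝ Ω
  irreducible : P.IsIrreducible
  aperiodic : IsAperiodic P

/-- `μ` is a stationary probability vector of `P`. -/
structure IsStationary (P : Matrix Ω Ω ℝ) (μ : Ω → ℝ) : Prop where
  prob : μ ∈ stdSimplex ℝ Ω
  invariant : Matrix.vecMul μ P = μ

/-- Distance from stationarity `sup_z TV(P^t(z, ·), μ)`. -/
def dMix (P : Matrix Ω Ω ℝ) (μ : Ω → ℝ) (t : ℕ) : ℝ :=
  ⨆ x : Ω, tvDist ((P ^ t) x) μ

/-- `τ_mix(ε)`, the least `t ≥ 1` with `dMix t ≤ ε`. -/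
def mixingTime (P : Matrix Ω Ω ℝ) (μ : Ω → ℝ) (ε : ℝ) : ℕ :=
  sInf {t : ℕ | 1 ≤ t ∧ dMix P μ t ≤ ε}

/-- `τ_mix = τ_mix(1/4)`. -/
def tauMix (P : Matrix Ω Ω ℝ) (μ : Ω → ℝ) : ℕ :=
  mixingTime P μ (1 / 4)

end Chain

/-- `z 0, z 1, …` is a time-homogeneous Markov chain with transition matrix `P` under `Pr`,
with an arbitrary initial distribution. -/
structure IsMarkovChain {S Ω : Type*} [MeasurableSpace S] [MeasurableSpace Ω]
    (Pr : Measure S) (P : Matrix Ω Ω ℝ) (z : ℕ → S → Ω) : Prop where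
  measurable : ∀ n, Measurable (z n)
  step : ∀ (n : ℕ) (x : ℕ → Ω),
    Pr.real {s | ∀ i ≤ n + 1, z i s = x i} =
      Pr.real {s | ∀ i ≤ n, z i s = x i} * P (x n) (x (n + 1))

/-- `J 0, J 1, …` are independent with law `Geom(1/2)` on `{1, 2, …}`. -/
structure IsGeomLevels {S : Type*} [MeasurableSpace S]
    (Pr : Measure S) (J : ℕ → S → ℕ) : Prop where
  measurable : ∀ t, Measurable (J t)
  law : ∀ t j : ℕ, 1 ≤ j → Pr.real {s | J t s = j} = (1 / 2 : ℝ) ^ j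
  indep : iIndepFun J Pr

/-! ### The algorithm, run on a given sample path and given levels -/

section Algorithm

/-- Number of samples used by an iteration with level `j`. -/
def numSamples (T j : ℕ) : ℕ :=
  if 2 ^ j ≤ T then 2 ^ j else 1

/-- Number of samples used by the first `t` iterations. -/
def totalSamples (T : ℕ) (J : ℕ → ℕ) (t : ℕ) : ℕ :=
  ∑ k ∈ Finset.range t, numSamples T (J k)

variable {E Ω : Type*} [NormedAddCommGroup E] [InnerProductSpace ℝ E]

/-- Average of the stochastic gradients at `w` over the first `2^j` samples of the path `x`. -/
def batchGrad (gradf : E → Ω → E) (w : E) (x : ℕ → Ω) (j : ℕ) : E :=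
  ((2 : ℝ) ^ j)⁻¹ • ∑ i ∈ Finset.range (2 ^ j), gradf w (x i)

/-- The multi-level Monte Carlo gradient estimator with level `j ≥ 1`. -/
def mlmcGrad (T : ℕ) (gradf : E → Ω → E) (w : E) (x : ℕ → Ω) (j : ℕ) : E :=
  batchGrad gradf w x 0 +
    if 2 ^ j ≤ T then (2 : ℝ) ^ j • (batchGrad gradf w x j - batchGrad gradf w x (j - 1)) else 0

open Classical in
/-- Metric projection onto `K`: a point of `K` nearest to `v`
(it exists and is unique when `K` is nonempty, closed and convex in finite dimension). -/
def proj (K : Set E) (v : E) : E :=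
  if h : ∃ y ∈ K, ∀ u ∈ K, ‖v - y‖ ≤ ‖v - u‖ then h.choose else v

/-- State after `t` iterations: the current iterate (started at `w₁`), and the sum of the squared
norms of the gradient estimates so far. Iterations are numbered from `0`; iteration `t` reads the
sample path `z` from the first sample that the earlier iterations did not use. -/
def state (K : Set E) (α : ℝ) (T : ℕ) (gradf : E → Ω → E) (w₁ : E)
    (z : ℕ → Ω) (J : ℕ → ℕ) : ℕ → E × ℝ
  | 0 => (w₁, 0)
  | t + 1 =>
    let w := (state K α T gradf w₁ z J t).1
    let g := mlmcGrad T gradf w (fun i => z (totalSamples T J t + i)) (J t)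
    let s := (state K α T gradf w₁ z J t).2 + ‖g‖ ^ 2
    (proj K (w - (α / √s) • g), s)

/-- The output of the algorithm: the average of its first `T` iterates. -/
def output (K : Set E) (α : ℝ) (T : ℕ) (gradf : E → Ω → E) (w₁ : E)
    (z : ℕ → Ω) (J : ℕ → ℕ) : E :=
  (T : ℝ)⁻¹ • ∑ t ∈ Finset.range T, (state K α T gradf w₁ z J t).1

end Algorithm

/-- The objective `F(w) = E_{z ∼ μ} f(w; z)`. -/
def objective {E Ω : Type*} [Fintype Ω] (μ : Ω → ℝ) (f : E → Ω → ℝ) (w : E) : ℝ :=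
  ∑ x, μ x * f w x

end MAG

end

/-!
The estimate combines an online regret bound, valid on every sample path, with conditional bounds
on the first two moments of the gradient estimates.

*Regret.* Whatever the vectors `g_t` are, projected descent with steps `α / √(∑_{k ≤ t} ‖g_k‖²)` and
`α = D / √2` satisfies `∑_t ⟪g_t, w_t - u⟫ ≤ √2 D √(∑_t ‖g_t‖²)` (`sum_inner_le_sqrt`). Convexity of
the objective and Jensen's inequality turn this into a bound for the averaged iterate
(`objective_output_sub_le`), in which only `𝔼 ‖g_t‖²` and the bias
`𝔼 ⟪∇F(w_t) - g_t, w_t - u⟫` remain to be estimated.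

*Batches.* Over the mixing time the transition matrix halves the `ℓ¹` norm of mass zero vectors, so
`P ^ k` approaches stationarity like `2 ^ (-⌊k / τ⌋)` (`sum_abs_pow_sub_le`); that the mixing time is
attained at all is the convergence theorem for ergodic chains (`tauMix_spec`). Correlations of
centered observables along the chain decay at the same rate from any initial state, so a batch of
`2 ^ j` stochastic gradients has mean squared error at most `16 G² τ / 2 ^ j`
(`IsMarkovChain.integral_batchGrad_sub_sq_le`).

*Levels.* Fix the levels of the earlier iterations and the samples they consumed. The iterate `w_t` is
then a constant, the unused samples again form a Markov chain (`IsMarkovChain.restrict_shift`), and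
the new level is independent of them. Since level `l` has probability `2 ^ (-l)`, the conditional
mean of `g_t` telescopes to that of the largest admissible batch, of size at least `T / 2`, which makes
the bias `O(D G √(τ / T))` (`setIntegral_inner_meanGrad_sub_mlmcGrad_le`). In the second moment the
weight `4 ^ l`, the probability `2 ^ (-l)` and the variance `O(2 ^ (-l))` cancel, so each of the
`log₂ T` levels contributes `O(G² τ)` (`setIntegral_norm_mlmcGrad_sq_le`). As all random quantities
are functions of countably valued variables, conditioning amounts to integrating over the cells of a
countable partition (`integral_le_of_past`).
-/

namespace MAG

/-! ### Mixing of a finite ergodic chain -/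

section Mixing

variable {Ω : Type*} [Fintype Ω]

/-- The `ℓ¹` distance of two vectors of equal mass is at most twice their total variation
distance. -/
lemma sum_abs_sub_le_two_mul_tvDist (p q : Ω → ℝ) (h : ∑ x, p x = ∑ x, q x) :
    ∑ x, |p x - q x| ≤ 2 * tvDist p q := by
  classical
  have hbdd : BddAbove (Set.range fun A : Finset Ω => |∑ x ∈ A, p x - ∑ x ∈ A, q x|) :=
    (Set.finite_range _).bddAbove
  set A : Finset Ω := Finset.univ.filter fun x => q x ≤ p x
  have h1 : |∑ x ∈ A, p x - ∑ x ∈ A, q x| ≤ tvDist p q := le_ciSup hbdd A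
  have hA : ∑ x ∈ A, |p x - q x| = ∑ x ∈ A, p x - ∑ x ∈ A, q x := by
    rw [← Finset.sum_sub_distrib]
    refine Finset.sum_congr rfl fun x hx => abs_of_nonneg ?_
    have := (Finset.mem_filter.mp hx).2
    linarith
  have hAc : ∑ x ∈ Aᶜ, |p x - q x| = ∑ x ∈ Aᶜ, q x - ∑ x ∈ Aᶜ, p x := by
    rw [← Finset.sum_sub_distrib]
    refine Finset.sum_congr rfl fun x hx => ?_
    have : ¬ q x ≤ p x := fun hle =>
      (Finset.mem_compl.mp hx) (Finset.mem_filter.mpr ⟨Finset.mem_univ _, hle⟩)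
    rw [abs_of_nonpos (by linarith)]
    ring
  have e1 := Finset.sum_add_sum_compl A fun x => |p x - q x|
  have e2 := Finset.sum_add_sum_compl A p
  have e3 := Finset.sum_add_sum_compl A q
  have := le_abs_self (∑ x ∈ A, p x - ∑ x ∈ A, q x)
  linarith

lemma tvDist_le_sum_abs_sub (p q : Ω → ℝ) : tvDist p q ≤ ∑ x, |p x - q x| := by
  refine ciSup_le fun A => ?_
  rw [← Finset.sum_sub_distrib]
  refine (Finset.abs_sum_le_sum_abs _ _).trans ?_
  exact Finset.sum_le_sum_of_subset_of_nonneg (Finset.subset_univ _) fun _ _ _ => abs_nonneg _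

/-- A matrix all of whose rows are within `c` of the same vector in `ℓ¹` contracts vectors of
mass zero by the factor `c`. -/
lemma sum_abs_vecMul_le_of_rows_close {Q : Matrix Ω Ω ℝ} {m : Ω → ℝ} {c : ℝ}
    (hQ : ∀ x, ∑ y, |Q x y - m y| ≤ c) {v : Ω → ℝ} (hv : ∑ x, v x = 0) :
    ∑ y, |Matrix.vecMul v Q y| ≤ c * ∑ x, |v x| := by
  have h1 : ∀ y, |Matrix.vecMul v Q y| ≤ ∑ x, |v x| * |Q x y - m y| := by
    intro y
    have : Matrix.vecMul v Q y = ∑ x, v x * (Q x y - m y) := by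
      simp only [Matrix.vecMul, dotProduct, mul_sub, Finset.sum_sub_distrib, ← Finset.sum_mul, hv]
      ring
    rw [this]
    refine (Finset.abs_sum_le_sum_abs _ _).trans (le_of_eq ?_)
    simp [abs_mul]
  refine (Finset.sum_le_sum fun y _ => h1 y).trans ?_
  rw [Finset.sum_comm, Finset.mul_sum]
  refine Finset.sum_le_sum fun x _ => ?_
  rw [← Finset.mul_sum, mul_comm]
  exact mul_le_mul_of_nonneg_right (hQ x) (abs_nonneg _)

lemma IsStationary.nonempty {P : Matrix Ω Ω ℝ} {m : Ω → ℝ} (hm : IsStationary P m) :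
    Nonempty Ω := by
  by_contra h
  rw [not_nonempty_iff] at h
  have := hm.prob.2
  simp at this

variable [DecidableEq Ω]

lemma vecMul_pow_of_invariant {P : Matrix Ω Ω ℝ} {m : Ω → ℝ} (h : Matrix.vecMul m P = m) (k : ℕ) :
    Matrix.vecMul m (P ^ k) = m := by
  induction k with
  | zero => simp
  | succ k ih => rw [pow_succ, ← Matrix.vecMul_vecMul, ih, h]

lemma pow_add_row_sub {P : Matrix Ω Ω ℝ} {m : Ω → ℝ} (h : Matrix.vecMul m P = m) (j k : ℕ) (x : Ω) :
    (fun y => (P ^ (j + k)) x y - m y) = Matrix.vecMul (fun y => (P ^ j) x y - m y) (P ^ k) := by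
  have e : (fun y => (P ^ j) x y - m y) = (P ^ j) x - m := rfl
  rw [e, Matrix.sub_vecMul, vecMul_pow_of_invariant h]
  funext y
  simp [pow_add, Matrix.mul_apply, Matrix.vecMul, dotProduct]

/-- Iterated contraction: if `P ^ n` contracts mass zero vectors by the factor `c`, then the
distances of the rows of `P ^ k` to the stationary vector decay like `c ^ ⌊k / n⌋`. -/
lemma sum_abs_pow_sub_le_of_contraction {P : Matrix Ω Ω ℝ} (hP : P ∈ Matrix.rowStochastic ℝ Ω)
    {m : Ω → ℝ} (hm : IsStationary P m) {n : ℕ} {c : ℝ} (hc : 0 ≤ c)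
    (hn : ∀ v : Ω → ℝ, ∑ x, v x = 0 →
      ∑ y, |Matrix.vecMul v (P ^ n) y| ≤ c * ∑ x, |v x|) (x : Ω) (r q : ℕ) :
    ∑ y, |(P ^ (r + n * q)) x y - m y| ≤ 2 * c ^ q := by
  have hmass : ∀ k, ∑ y, ((P ^ k) x y - m y) = 0 := fun k => by
    rw [Finset.sum_sub_distrib, Matrix.sum_row_of_mem_rowStochastic (pow_mem hP k), hm.prob.2]
    ring
  induction q with
  | zero =>
    have : ∀ y, |(P ^ (r + n * 0)) x y - m y| ≤ (P ^ r) x y + m y := fun y => by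
      have h1 := Matrix.nonneg_of_mem_rowStochastic (pow_mem hP r) (i := x) (j := y)
      have h2 := hm.prob.1 y
      rw [mul_zero, add_zero, abs_le]
      constructor <;> linarith
    refine (Finset.sum_le_sum fun y _ => this y).trans ?_
    rw [Finset.sum_add_distrib, Matrix.sum_row_of_mem_rowStochastic (pow_mem hP r), hm.prob.2]
    norm_num
  | succ q ih =>
    have e : r + n * (q + 1) = (r + n * q) + n := by ring
    have h1 := hn _ (hmass (r + n * q))
    rw [← pow_add_row_sub hm.invariant] at h1
    rw [e]
    calc _ ≤ c * ∑ y, |(P ^ (r + n * q)) x y - m y| := h1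
      _ ≤ c * (2 * c ^ q) := mul_le_mul_of_nonneg_left ih hc
      _ = 2 * c ^ (q + 1) := by ring

/-- The return times to a state of an ergodic chain contain all large integers. -/
lemma IsErgodic.eventually_return_pos {P : Matrix Ω Ω ℝ} (hP : IsErgodic P) (x : Ω) :
    ∃ N, ∀ n ≥ N, 0 < (P ^ n) x x := by
  have hnn := fun k => fun i j => Matrix.nonneg_of_mem_rowStochastic (pow_mem hP.stochastic k)
    (i := i) (j := j)
  -- The return times generate a numerical semigroup of greatest common divisor one.
  set s : Set ℕ := {t | 1 ≤ t ∧ 0 < (P ^ t) x x}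
  have hgcd : Nat.setGcd s = 1 :=
    hP.aperiodic x _ fun t ht hpos => Nat.setGcd_dvd_of_mem ⟨ht, hpos⟩
  obtain ⟨N, hN⟩ := Nat.exists_mem_closure_of_ge s
  refine ⟨N, fun n hn => ?_⟩
  have hmem := hN n hn (by rw [hgcd]; exact one_dvd n)
  refine AddSubmonoid.closure_induction (motive := fun k _ => 0 < (P ^ k) x x) (fun k hk => hk.2)
    (by simp) (fun a b _ _ ha hb => ?_) hmem
  rw [pow_add, Matrix.mul_apply]
  exact Finset.sum_pos' (fun y _ => mul_nonneg (hnn a _ _) (hnn b _ _))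
    ⟨x, Finset.mem_univ _, mul_pos ha hb⟩

/-- Some power of an ergodic transition matrix is entrywise positive. -/
lemma IsErgodic.exists_pow_pos {P : Matrix Ω Ω ℝ} (hP : IsErgodic P) :
    ∃ n, ∀ x y, 0 < (P ^ n) x y := by
  have hnn := fun k => fun i j => Matrix.nonneg_of_mem_rowStochastic (pow_mem hP.stochastic k)
    (i := i) (j := j)
  choose N hN using hP.eventually_return_pos
  have hirr := (Matrix.isIrreducible_iff_exists_pow_pos hP.irreducible.nonneg).1 hP.irreducible
  choose k hk using fun x y => hirr x y
  set M := (∑ x, N x) + ∑ x, ∑ y, k x y with hM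
  refine ⟨M, fun x y => ?_⟩
  have h1 : N x ≤ ∑ x, N x := Finset.single_le_sum (fun _ _ => Nat.zero_le _) (Finset.mem_univ x)
  have h2 : k x y ≤ ∑ y, k x y :=
    Finset.single_le_sum (f := fun y => k x y) (fun _ _ => Nat.zero_le _) (Finset.mem_univ y)
  have h3 : ∑ y, k x y ≤ ∑ x, ∑ y, k x y :=
    Finset.single_le_sum (f := fun x => ∑ y, k x y) (fun _ _ => Nat.zero_le _) (Finset.mem_univ x)
  have e : M = (M - k x y) + k x y := by omega
  rw [e, pow_add, Matrix.mul_apply]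
  exact Finset.sum_pos' (fun z _ => mul_nonneg (hnn _ _ _) (hnn _ _ _))
    ⟨x, Finset.mem_univ _, mul_pos (hN x _ (by omega)) (hk x y).2⟩

/-- Doeblin's argument: an entrywise positive stochastic matrix contracts mass zero vectors. -/
lemma exists_contraction_of_pos [Nonempty Ω] {Q : Matrix Ω Ω ℝ}
    (hQ : Q ∈ Matrix.rowStochastic ℝ Ω) (hpos : ∀ x y, 0 < Q x y) :
    ∃ c : ℝ, 0 ≤ c ∧ c < 1 ∧ ∀ v : Ω → ℝ, ∑ x, v x = 0 →
      ∑ y, |Matrix.vecMul v Q y| ≤ c * ∑ x, |v x| := by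
  obtain ⟨⟨a, b⟩, -, hab⟩ := Finset.exists_min_image (Finset.univ : Finset (Ω × Ω))
    (fun p => Q p.1 p.2) Finset.univ_nonempty
  set δ := Q a b
  have hδ : 0 < δ := hpos a b
  have hle : ∀ x y, δ ≤ Q x y := fun x y => hab (x, y) (Finset.mem_univ _)
  have hrow : ∀ x, ∑ y, |Q x y - δ| = 1 - Fintype.card Ω * δ := fun x => by
    rw [Finset.sum_congr rfl fun y _ => abs_of_nonneg (sub_nonneg.2 (hle x y)),
      Finset.sum_sub_distrib, Matrix.sum_row_of_mem_rowStochastic hQ]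
    simp
  refine ⟨1 - Fintype.card Ω * δ, ?_, ?_, fun v hv =>
    sum_abs_vecMul_le_of_rows_close (m := fun _ => δ) (fun x => (hrow x).le) hv⟩
  · rw [← hrow a]
    exact Finset.sum_nonneg fun _ _ => abs_nonneg _
  · have : (0 : ℝ) < Fintype.card Ω := by exact_mod_cast Fintype.card_pos
    nlinarith

/-- The mixing time is attained, by the convergence theorem for ergodic chains; in particular it is
not the default value of the infimum of an empty set. -/
lemma tauMix_spec {P : Matrix Ω Ω ℝ} {m : Ω → ℝ} (hP : IsErgodic P) (hm : IsStationary P m) :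
    1 ≤ tauMix P m ∧ dMix P m (tauMix P m) ≤ 1 / 4 := by
  have := hm.nonempty
  refine Nat.sInf_mem (s := {t : ℕ | 1 ≤ t ∧ dMix P m t ≤ 1 / 4}) ?_
  obtain ⟨n, hn⟩ := hP.exists_pow_pos
  obtain ⟨c, hc0, hc1, hc⟩ := exists_contraction_of_pos (pow_mem hP.stochastic n) hn
  obtain ⟨q, hq⟩ := exists_pow_lt_of_lt_one (show (0 : ℝ) < 1 / 8 by norm_num) hc1
  refine ⟨1 + n * q, by omega, ciSup_le fun x => ?_⟩
  refine (tvDist_le_sum_abs_sub _ _).trans ?_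
  refine (sum_abs_pow_sub_le_of_contraction hP.stochastic hm hc0 hc x 1 q).trans ?_
  linarith

/-- Geometric decay of the distance to stationarity on the time scale of the mixing time. -/
lemma sum_abs_pow_sub_le {P : Matrix Ω Ω ℝ} {m : Ω → ℝ} (hP : IsErgodic P)
    (hm : IsStationary P m) (x : Ω) (k : ℕ) :
    ∑ y, |(P ^ k) x y - m y| ≤ 2 * (1 / 2 : ℝ) ^ (k / tauMix P m) := by
  obtain ⟨-, h2⟩ := tauMix_spec hP hm
  have hrows : ∀ x, ∑ y, |(P ^ tauMix P m) x y - m y| ≤ 1 / 2 := fun x => by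
    have h3 : tvDist ((P ^ tauMix P m) x) m ≤ dMix P m (tauMix P m) :=
      le_ciSup (f := fun x => tvDist ((P ^ tauMix P m) x) m) (Set.finite_range _).bddAbove x
    have h4 := sum_abs_sub_le_two_mul_tvDist ((P ^ tauMix P m) x) m (by
      rw [Matrix.sum_row_of_mem_rowStochastic (pow_mem hP.stochastic _), hm.prob.2])
    linarith
  have := sum_abs_pow_sub_le_of_contraction hP.stochastic hm (by norm_num : (0 : ℝ) ≤ 1 / 2)
    (fun v hv => sum_abs_vecMul_le_of_rows_close hrows hv) x (k % tauMix P m) (k / tauMix P m)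
  rwa [Nat.mod_add_div] at this

lemma sum_range_half_pow_div_le {τ : ℕ} (hτ : 1 ≤ τ) (n : ℕ) :
    ∑ k ∈ Finset.range n, (1 / 2 : ℝ) ^ (k / τ) ≤ 2 * τ := by
  have hτ' : 0 < τ := hτ
  have hmul : ∀ q : ℕ, ∑ k ∈ Finset.range (τ * q), (1 / 2 : ℝ) ^ (k / τ) =
      2 * τ * (1 - (1 / 2) ^ q) := by
    intro q
    induction q with
    | zero => simp
    | succ q ih =>
      rw [Nat.mul_succ, Finset.sum_range_add, ih]
      have : ∀ i ∈ Finset.range τ, (1 / 2 : ℝ) ^ ((τ * q + i) / τ) = (1 / 2) ^ q := fun i hi => by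
        rw [Nat.mul_add_div hτ', Nat.div_eq_of_lt (Finset.mem_range.1 hi), add_zero]
      rw [Finset.sum_congr rfl this]
      simp only [Finset.sum_const, Finset.card_range, nsmul_eq_mul]
      ring
  have hsub : Finset.range n ⊆ Finset.range (τ * n) :=
    Finset.range_subset_range.2 (Nat.le_mul_of_pos_left n hτ')
  refine (Finset.sum_le_sum_of_subset_of_nonneg hsub fun _ _ _ => by positivity).trans ?_
  rw [hmul]
  have : (0 : ℝ) ≤ 2 * τ * (1 / 2) ^ n := by positivity
  linarith

end Mixing

section Deterministic

variable {E Ω : Type*} [NormedAddCommGroup E] [InnerProductSpace ℝ E]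

/-! ### Metric projection -/

section Projection

variable [ProperSpace E] {K : Set E}

omit [InnerProductSpace ℝ E] in
lemma proj_mem (hK : IsClosed K) (hne : K.Nonempty) (v : E) :
    proj K v ∈ K ∧ ∀ u ∈ K, ‖v - proj K v‖ ≤ ‖v - u‖ := by
  have h : ∃ y ∈ K, ∀ u ∈ K, ‖v - y‖ ≤ ‖v - u‖ := by
    obtain ⟨y, hy, hd⟩ := hK.exists_infDist_eq_dist hne v
    refine ⟨y, hy, fun u hu => ?_⟩
    rw [← dist_eq_norm, ← dist_eq_norm, ← hd]
    exact Metric.infDist_le_dist_of_mem hu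
  rw [proj, dif_pos h]
  exact h.choose_spec

/-- Projecting onto a convex set does not increase the distance to its points. -/
lemma norm_proj_sub_le (hK : IsClosed K) (hc : Convex ℝ K) {u : E} (hu : u ∈ K) (v : E) :
    ‖proj K v - u‖ ≤ ‖v - u‖ := by
  obtain ⟨hp, hmin⟩ := proj_mem hK ⟨u, hu⟩ v
  have : Nonempty K := ⟨⟨u, hu⟩⟩
  have heq : ‖v - proj K v‖ = ⨅ w : K, ‖v - w‖ :=
    le_antisymm (le_ciInf fun w => hmin w w.2)
      (ciInf_le ⟨0, by rintro _ ⟨w, rfl⟩; exact norm_nonneg _⟩ (⟨_, hp⟩ : K))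
  have h := (norm_eq_iInf_iff_real_inner_le_zero hc hp).1 heq u hu
  have e : v - u = (v - proj K v) - (u - proj K v) := by abel
  have h2 : ‖v - u‖ ^ 2 = ‖v - proj K v‖ ^ 2 - 2 * inner ℝ (v - proj K v) (u - proj K v)
      + ‖u - proj K v‖ ^ 2 := by rw [e]; exact norm_sub_sq_real _ _
  rw [norm_sub_rev (proj K v) u]
  refine le_of_sq_le_sq ?_ (norm_nonneg _)
  nlinarith [sq_nonneg ‖v - proj K v‖]

end Projection

/-! ### Locality of the algorithm -/

section Locality

lemma totalSamples_succ (T : ℕ) (J : ℕ → ℕ) (t : ℕ) :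
    totalSamples T J (t + 1) = totalSamples T J t + numSamples T (J t) :=
  Finset.sum_range_succ _ _

lemma totalSamples_congr {T : ℕ} {J J' : ℕ → ℕ} {t : ℕ} (h : ∀ k < t, J k = J' k) :
    totalSamples T J t = totalSamples T J' t :=
  Finset.sum_congr rfl fun k hk => by rw [h k (Finset.mem_range.1 hk)]

lemma numSamples_le {T : ℕ} (hT : 1 ≤ T) (j : ℕ) : numSamples T j ≤ T := by
  unfold numSamples
  split_ifs with h
  exacts [h, hT]

lemma totalSamples_le {T : ℕ} (hT : 1 ≤ T) (J : ℕ → ℕ) (t : ℕ) : totalSamples T J t ≤ t * T := by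
  refine (Finset.sum_le_card_nsmul _ _ T fun k _ => numSamples_le hT (J k)).trans ?_
  simp

lemma batchGrad_congr (gradf : E → Ω → E) (w : E) {x y : ℕ → Ω} {j : ℕ}
    (h : ∀ i < 2 ^ j, x i = y i) : batchGrad gradf w x j = batchGrad gradf w y j := by
  unfold batchGrad
  rw [Finset.sum_congr rfl fun i hi => by rw [h i (Finset.mem_range.1 hi)]]

lemma mlmcGrad_congr {T : ℕ} (gradf : E → Ω → E) (w : E) {x y : ℕ → Ω} {j : ℕ}
    (h : ∀ i < numSamples T j, x i = y i) : mlmcGrad T gradf w x j = mlmcGrad T gradf w y j := by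
  unfold mlmcGrad
  unfold numSamples at h
  split_ifs at h ⊢ with hj
  · have hpos : 0 < 2 ^ j := by positivity
    have hle : 2 ^ (j - 1) ≤ 2 ^ j := Nat.pow_le_pow_right (by norm_num) (Nat.sub_le j 1)
    rw [batchGrad_congr gradf w (j := 0) fun i hi => h i (by simp at hi; omega),
      batchGrad_congr gradf w (j := j) h,
      batchGrad_congr gradf w (j := j - 1) fun i hi => h i (by omega)]
  · rw [batchGrad_congr gradf w (j := 0) fun i hi => h i (by simpa using hi)]

/-- The gradient estimate used by iteration `t`. -/
noncomputable def gradEst (K : Set E) (α : ℝ) (T : ℕ) (gradf : E → Ω → E) (w₁ : E)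
    (z : ℕ → Ω) (J : ℕ → ℕ) (t : ℕ) : E :=
  mlmcGrad T gradf (state K α T gradf w₁ z J t).1 (fun i => z (totalSamples T J t + i)) (J t)

lemma gradEst_congr_of_state {K : Set E} {α : ℝ} {T : ℕ} {gradf : E → Ω → E} {w₁ : E}
    {z z' : ℕ → Ω} {J J' : ℕ → ℕ} {t : ℕ} (hJ : ∀ k < t + 1, J k = J' k)
    (hz : ∀ i < totalSamples T J (t + 1), z i = z' i)
    (h : state K α T gradf w₁ z J t = state K α T gradf w₁ z' J' t) :
    gradEst K α T gradf w₁ z J t = gradEst K α T gradf w₁ z' J' t := by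
  rw [totalSamples_succ] at hz
  rw [gradEst, gradEst, h, ← hJ t (by omega),
    ← totalSamples_congr (T := T) fun k hk => hJ k (by omega)]
  exact mlmcGrad_congr gradf _ fun i hi => hz _ (by omega)

/-- The first `t` iterations look only at the first `t` levels and the samples they consume. -/
lemma state_congr {K : Set E} {α : ℝ} {T : ℕ} {gradf : E → Ω → E} {w₁ : E} {z z' : ℕ → Ω}
    {J J' : ℕ → ℕ} {t : ℕ} (hJ : ∀ k < t, J k = J' k)
    (hz : ∀ i < totalSamples T J t, z i = z' i) :
    state K α T gradf w₁ z J t = state K α T gradf w₁ z' J' t := by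
  induction t with
  | zero => rfl
  | succ t ih =>
    have h1 := ih (fun k hk => hJ k (by omega)) fun i hi => hz i (by
      rw [totalSamples_succ]
      omega)
    have h2 := gradEst_congr_of_state hJ hz h1
    simp only [gradEst] at h2
    simp only [state]
    rw [h2, h1]

lemma gradEst_congr {K : Set E} {α : ℝ} {T : ℕ} {gradf : E → Ω → E} {w₁ : E}
    {z z' : ℕ → Ω} {J J' : ℕ → ℕ} {t : ℕ} (hJ : ∀ k < t + 1, J k = J' k)
    (hz : ∀ i < totalSamples T J (t + 1), z i = z' i) :
    gradEst K α T gradf w₁ z J t = gradEst K α T gradf w₁ z' J' t :=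
  gradEst_congr_of_state hJ hz <| state_congr (fun k hk => hJ k (by omega)) fun i hi =>
    hz i (by rw [totalSamples_succ]; omega)

end Locality

/-! ### The regret of projected gradient descent with scalar adaptive steps -/

section Regret

variable {K : Set E} {α : ℝ} {T : ℕ} {gradf : E → Ω → E} {w₁ : E} {z : ℕ → Ω} {J : ℕ → ℕ}

lemma state_snd (t : ℕ) : (state K α T gradf w₁ z J t).2 =
    ∑ k ∈ Finset.range t, ‖gradEst K α T gradf w₁ z J k‖ ^ 2 := by
  induction t with
  | zero => rfl
  | succ t ih =>
    rw [Finset.sum_range_succ, ← ih]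
    rfl

variable [ProperSpace E]

lemma state_mem (hK : IsClosed K) (hw : w₁ ∈ K) (t : ℕ) :
    (state K α T gradf w₁ z J t).1 ∈ K := by
  cases t with
  | zero => exact hw
  | succ t => exact (proj_mem hK ⟨w₁, hw⟩ _).1

/-- One step of projected gradient descent, for an arbitrary step size `a / r`. -/
lemma inner_le_of_proj_step (hK : IsClosed K) (hc : Convex ℝ K) {u : E} (hu : u ∈ K) (w g : E)
    {a r : ℝ} (ha : 0 < a) (hr : 0 < r) :
    inner ℝ g (w - u) ≤ r / (2 * a) * (‖w - u‖ ^ 2 - ‖proj K (w - (a / r) • g) - u‖ ^ 2)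
      + a * ‖g‖ ^ 2 / (2 * r) := by
  have h1 := norm_proj_sub_le hK hc hu (w - (a / r) • g)
  have h2 : ‖proj K (w - (a / r) • g) - u‖ ^ 2 ≤ ‖w - (a / r) • g - u‖ ^ 2 := by gcongr
  have e : w - (a / r) • g - u = (w - u) - (a / r) • g := by abel
  rw [e, norm_sub_sq_real (w - u), inner_smul_right, norm_smul, real_inner_comm, mul_pow,
    Real.norm_eq_abs, sq_abs] at h2
  have h3 : r / (2 * a) * (‖w - u‖ ^ 2 - 2 * (a / r * inner ℝ g (w - u)) + (a / r) ^ 2 * ‖g‖ ^ 2)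
      = r / (2 * a) * ‖w - u‖ ^ 2 - inner ℝ g (w - u) + a * ‖g‖ ^ 2 / (2 * r) := by
    field_simp
  have h4 := mul_le_mul_of_nonneg_left h2 (show 0 ≤ r / (2 * a) by positivity)
  rw [h3] at h4
  linarith

/-- The regret of the adaptive method, with the potential term kept for the induction. -/
lemma sum_inner_le_potential (hK : IsClosed K) (hc : Convex ℝ K) (hw : w₁ ∈ K) {D : ℝ}
    (hD : ∀ x ∈ K, ∀ y ∈ K, ‖x - y‖ ≤ D) {u : E} (hu : u ∈ K) (hα : 0 < α) (t : ℕ) :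
    ∑ k ∈ Finset.range t, inner ℝ (gradEst K α T gradf w₁ z J k)
        ((state K α T gradf w₁ z J k).1 - u) ≤
      √(state K α T gradf w₁ z J t).2 / (2 * α) *
        (D ^ 2 - ‖(state K α T gradf w₁ z J t).1 - u‖ ^ 2) +
      α * √(state K α T gradf w₁ z J t).2 := by
  induction t with
  | zero => simp [state]
  | succ t ih =>
    rw [Finset.sum_range_succ]
    set w := (state K α T gradf w₁ z J t).1 with hwdef
    set g := gradEst K α T gradf w₁ z J t with hg
    set s := (state K α T gradf w₁ z J t).2 with hs
    have hs0 : 0 ≤ s := by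
      rw [hs, state_snd]
      exact Finset.sum_nonneg fun _ _ => by positivity
    have e2 : (state K α T gradf w₁ z J (t + 1)).2 = s + ‖g‖ ^ 2 := rfl
    have e1 : (state K α T gradf w₁ z J (t + 1)).1 = proj K (w - (α / √(s + ‖g‖ ^ 2)) • g) := rfl
    rw [e1, e2]
    have hwK : w ∈ K := state_mem hK hw t
    have hwD : ‖w - u‖ ^ 2 ≤ D ^ 2 := by
      have := hD w hwK u hu
      gcongr
    rcases (by positivity : 0 ≤ s + ‖g‖ ^ 2).eq_or_lt with h0 | h0
    · -- All gradients so far vanish, and the step is zero.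
      have hg0 : g = 0 := by
        have : ‖g‖ ^ 2 = 0 := le_antisymm (by linarith) (by positivity)
        simpa using this
      have hs00 : s = 0 := le_antisymm (by nlinarith [sq_nonneg ‖g‖]) hs0
      rw [hs00] at ih
      rw [hg0, hs00]
      simpa using ih
    · set r := √(s + ‖g‖ ^ 2) with hr
      have hr0 : 0 < r := Real.sqrt_pos.2 h0
      have hrs : √s ≤ r := Real.sqrt_le_sqrt (by nlinarith [sq_nonneg ‖g‖])
      have hstep := inner_le_of_proj_step hK hc hu w g hα hr0
      have h1 : √s / (2 * α) * (D ^ 2 - ‖w - u‖ ^ 2) ≤ r / (2 * α) * (D ^ 2 - ‖w - u‖ ^ 2) :=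
        mul_le_mul_of_nonneg_right (by gcongr) (by linarith)
      have h2 : √s + ‖g‖ ^ 2 / (2 * r) ≤ r := by
        have hg2 : ‖g‖ ^ 2 = r ^ 2 - √s ^ 2 := by
          rw [hr, Real.sq_sqrt h0.le, Real.sq_sqrt hs0]; ring
        rw [hg2, ← le_sub_iff_add_le', div_le_iff₀ (by positivity)]
        nlinarith [Real.sqrt_nonneg s]
      have h3 := mul_le_mul_of_nonneg_left h2 hα.le
      have h4 : α * ‖g‖ ^ 2 / (2 * r) = α * (‖g‖ ^ 2 / (2 * r)) := by ring
      rw [h4] at hstep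
      linarith

/-- The regret bound: with `α = D / √2` the two terms of the potential balance. -/
lemma sum_inner_le_sqrt (hK : IsClosed K) (hc : Convex ℝ K) (hw : w₁ ∈ K) {D : ℝ}
    (hD : ∀ x ∈ K, ∀ y ∈ K, ‖x - y‖ ≤ D) {u : E} (hu : u ∈ K) (hα : α = D / √2) (t : ℕ) :
    ∑ k ∈ Finset.range t, inner ℝ (gradEst K α T gradf w₁ z J k)
        ((state K α T gradf w₁ z J k).1 - u) ≤
      √2 * D * √(∑ k ∈ Finset.range t, ‖gradEst K α T gradf w₁ z J k‖ ^ 2) := by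
  have hD0 : 0 ≤ D := by simpa using hD u hu u hu
  rcases hD0.eq_or_lt with rfl | hDpos
  · -- The set is a single point.
    simp only [mul_zero, zero_mul]
    refine Finset.sum_nonpos fun k _ => ?_
    have := hD _ (state_mem (α := α) (T := T) (gradf := gradf) (z := z) (J := J) hK hw k) u hu
    rw [norm_le_zero_iff.1 this]
    simp
  · have h2 : (0 : ℝ) < √2 := by positivity
    have hsq : √2 * √2 = (2 : ℝ) := Real.mul_self_sqrt (by norm_num)
    have hα0 : 0 < α := by rw [hα]; positivity
    have h := sum_inner_le_potential (T := T) (gradf := gradf) (z := z) (J := J) hK hc hw hD hu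
      hα0 t
    rw [state_snd] at h
    refine h.trans ?_
    set r := √(∑ k ∈ Finset.range t, ‖gradEst K α T gradf w₁ z J k‖ ^ 2)
    have hr : 0 ≤ r := Real.sqrt_nonneg _
    have h3 : r / (2 * α) * (D ^ 2 - ‖(state K α T gradf w₁ z J t).1 - u‖ ^ 2) ≤
        r / (2 * α) * D ^ 2 := by
      gcongr
      nlinarith [sq_nonneg ‖(state K α T gradf w₁ z J t).1 - u‖]
    have hDα : D = √2 * α := by rw [hα]; field_simp
    have h4 : r / (2 * α) * D ^ 2 + α * r = √2 * D * r := by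
      rw [hDα]
      field_simp
      rw [show (√2 : ℝ) ^ 2 = 2 by rw [sq, hsq]]
      ring
    linarith

end Regret

end Deterministic

/-! ### The objective -/

section Objective

variable {E Ω : Type*} [NormedAddCommGroup E] [InnerProductSpace ℝ E] [Fintype Ω]

/-- The mean `E_{z ∼ μ} ∇f(w; z)` of the stochastic gradients, that is, `∇F(w)`. -/
def meanGrad (μ : Ω → ℝ) (gradf : E → Ω → E) (w : E) : E :=
  ∑ x, μ x • gradf w x

lemma norm_meanGrad_le {μ : Ω → ℝ} (hμ : μ ∈ stdSimplex ℝ Ω) {gradf : E → Ω → E} {w : E} {G : ℝ}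
    (hG : ∀ x, ‖gradf w x‖ ≤ G) : ‖meanGrad μ gradf w‖ ≤ G := by
  refine (norm_sum_le _ _).trans ?_
  calc ∑ x, ‖μ x • gradf w x‖ ≤ ∑ x, μ x * G := Finset.sum_le_sum fun x _ => by
        rw [norm_smul, Real.norm_of_nonneg (hμ.1 x)]
        exact mul_le_mul_of_nonneg_left (hG x) (hμ.1 x)
    _ = G := by rw [← Finset.sum_mul, hμ.2, one_mul]

/-- The gradient inequality for the objective; it only needs derivatives within `K`. -/
lemma objective_sub_le_inner [CompleteSpace E] {K : Set E} {μ : Ω → ℝ} {f : E → Ω → ℝ}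
    {gradf : E → Ω → E}
    (hf : ∀ w ∈ K, ∀ x, HasGradientWithinAt (fun v => f v x) (gradf w x) K w)
    (hF : ConvexOn ℝ K (objective μ f)) {w u : E} (hw : w ∈ K) (hu : u ∈ K) :
    objective μ f w - objective μ f u ≤ inner ℝ (meanGrad μ gradf w) (w - u) := by
  set γ : ℝ → E := fun r => w + r • (u - w)
  have hmaps : Set.MapsTo γ (Set.Icc 0 1) K := fun r hr =>
    hF.1.add_smul_sub_mem hw hu hr
  have hγ : HasDerivWithinAt γ (u - w) (Set.Icc 0 1) 0 := by
    have : HasDerivAt γ ((1 : ℝ) • (u - w)) 0 :=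
      ((hasDerivAt_id (0 : ℝ)).smul_const (u - w)).const_add w
    simpa using this.hasDerivWithinAt
  have hobj : HasFDerivWithinAt (objective μ f)
      (∑ x, μ x • InnerProductSpace.toDual ℝ E (gradf w x)) K (γ 0) := by
    have hγ0 : γ 0 = w := by simp [γ]
    rw [hγ0]
    refine HasFDerivWithinAt.fun_sum fun x _ => ?_
    exact (hf w hw x).hasFDerivWithinAt.const_mul (μ x)
  have hcomp := hobj.comp_hasDerivWithinAt (0 : ℝ) hγ hmaps
  have hconv : ConvexOn ℝ (Set.Icc (0 : ℝ) 1) (objective μ f ∘ γ) := by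
    refine ⟨convex_Icc 0 1, fun a ha b hb p q hp hq hpq => ?_⟩
    have e : γ (p • a + q • b) = p • γ a + q • γ b := by
      simp only [γ, smul_eq_mul, smul_add, smul_smul, add_smul]
      have : w = p • w + q • w := by rw [← add_smul, hpq, one_smul]
      nth_rewrite 1 [this]
      abel
    simp only [Function.comp, e]
    exact hF.2 (hmaps ha) (hmaps hb) hp hq hpq
  have hslope := hconv.le_slope_of_hasDerivWithinAt (x := 0) (y := 1) (by simp) (by simp)
    one_pos hcomp
  have e0 : γ 0 = w := by simp [γ]
  have e1 : γ 1 = u := by simp [γ]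
  rw [slope_def_field] at hslope
  simp only [Function.comp, e0, e1] at hslope
  have e2 : (∑ x, μ x • InnerProductSpace.toDual ℝ E (gradf w x)) (u - w) =
      - inner ℝ (meanGrad μ gradf w) (w - u) := by
    simp only [meanGrad, _root_.sum_apply, sum_inner, inner_smul_left]
    rw [← Finset.sum_neg_distrib]
    refine Finset.sum_congr rfl fun x _ => ?_
    rw [← neg_sub w u]
    simp only [smul_apply, InnerProductSpace.toDual_apply_apply, inner_neg_right]
    simp
  rw [e2] at hslope
  simp at hslope
  linarith

/-- The suboptimality of the averaged iterate, on every sample path: the regret bound plus the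
accumulated errors of the gradient estimates. -/
lemma objective_output_sub_le [ProperSpace E] {K : Set E} {μ : Ω → ℝ} {gradf : E → Ω → E}
    {w₁ : E} {T : ℕ} (hK : IsClosed K) (hw : w₁ ∈ K) {D : ℝ}
    (hD : ∀ x ∈ K, ∀ y ∈ K, ‖x - y‖ ≤ D) {f : E → Ω → ℝ}
    (hf : ∀ w ∈ K, ∀ x, HasGradientWithinAt (fun v => f v x) (gradf w x) K w)
    (hF : ConvexOn ℝ K (objective μ f)) {u : E} (hu : u ∈ K) (hT : 1 ≤ T) (x : ℕ → Ω)
    (j : ℕ → ℕ) :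
    output K (D / √2) T gradf w₁ x j ∈ K ∧
    objective μ f (output K (D / √2) T gradf w₁ x j) - objective μ f u ≤
      (T : ℝ)⁻¹ * (√2 * D * √(∑ t ∈ Finset.range T, ‖gradEst K (D / √2) T gradf w₁ x j t‖ ^ 2) +
        ∑ t ∈ Finset.range T, inner ℝ
          (meanGrad μ gradf (state K (D / √2) T gradf w₁ x j t).1 -
            gradEst K (D / √2) T gradf w₁ x j t)
          ((state K (D / √2) T gradf w₁ x j t).1 - u)) := by
  set w : ℕ → E := fun t => (state K (D / √2) T gradf w₁ x j t).1
  have hwK : ∀ t, w t ∈ K := fun t => state_mem hK hw t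
  have hT0 : (0 : ℝ) < T := by exact_mod_cast hT
  have hsum1 : ∑ _t ∈ Finset.range T, (T : ℝ)⁻¹ = 1 := by
    rw [Finset.sum_const, Finset.card_range, nsmul_eq_mul, mul_inv_cancel₀ hT0.ne']
  have hout : output K (D / √2) T gradf w₁ x j = ∑ t ∈ Finset.range T, (T : ℝ)⁻¹ • w t := by
    rw [output, Finset.smul_sum]
  rw [hout]
  refine ⟨hF.1.sum_mem (fun _ _ => by positivity) hsum1 fun t _ => hwK t, ?_⟩
  have hJensen := hF.map_sum_le (t := Finset.range T) (w := fun _ => (T : ℝ)⁻¹) (p := w)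
    (fun _ _ => by positivity) hsum1 fun t _ => hwK t
  have hgrad : ∀ t, objective μ f (w t) - objective μ f u ≤
      inner ℝ (gradEst K (D / √2) T gradf w₁ x j t) (w t - u) +
      inner ℝ (meanGrad μ gradf (w t) - gradEst K (D / √2) T gradf w₁ x j t) (w t - u) :=
    fun t => by
      rw [← inner_add_left, add_sub_cancel]
      exact objective_sub_le_inner hf hF (hwK t) hu
  have hregret := sum_inner_le_sqrt (T := T) (gradf := gradf) (z := x) (J := j) hK hF.1 hw hD hu
    rfl T
  calc objective μ f (∑ t ∈ Finset.range T, (T : ℝ)⁻¹ • w t) - objective μ f u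
      ≤ (T : ℝ)⁻¹ * ∑ t ∈ Finset.range T, (objective μ f (w t) - objective μ f u) := by
        rw [Finset.sum_sub_distrib, mul_sub, Finset.mul_sum, Finset.sum_const, Finset.card_range,
          nsmul_eq_mul, inv_mul_cancel_left₀ hT0.ne']
        simpa using hJensen
    _ ≤ _ := by
        refine mul_le_mul_of_nonneg_left ?_ (by positivity)
        refine (Finset.sum_le_sum fun t _ => hgrad t).trans ?_
        rw [Finset.sum_add_distrib]
        exact add_le_add_left hregret _

end Objective

/-! ### Integrals of functions of discrete random variables -/

section Discrete

variable {S ι : Type*} [MeasurableSpace S] [MeasurableSpace ι] [MeasurableSingletonClass ι]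

lemma integrable_comp_of_countable [Countable ι] {ν : Measure S} [IsFiniteMeasure ν] {H : S → ι}
    (hH : Measurable H) (φ : ι → ℝ) {c : ℝ} (hφ : ∀ s, |φ (H s)| ≤ c) :
    Integrable (fun s => φ (H s)) ν :=
  Integrable.of_bound ((measurable_of_countable φ).comp hH).aestronglyMeasurable c
    (Filter.Eventually.of_forall hφ)

/-- To compare two integrals it suffices to compare them on each fiber of a discrete random
variable. The fibers are written as `{H = H s₀}`, so that on each one a sample point is at hand. -/
lemma integral_le_integral_of_fibers [Countable ι] {ν : Measure S} {H : S → ι} (hH : Measurable H)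
    {X Y : S → ℝ} (hX : Integrable X ν) (hY : Integrable Y ν)
    (h : ∀ s₀, ∫ s in {s | H s = H s₀}, X s ∂ν ≤ ∫ s in {s | H s = H s₀}, Y s ∂ν) :
    ∫ s, X s ∂ν ≤ ∫ s, Y s ∂ν := by
  have hm : ∀ i, MeasurableSet {s | H s = i} := fun i => hH (measurableSet_singleton i)
  have hd : Pairwise (Function.onFun Disjoint fun i => {s | H s = i}) := fun i j hij =>
    Set.disjoint_left.2 fun s hs hs' => hij (hs.symm.trans hs')
  have hU : (⋃ i, {s | H s = i}) = Set.univ := Set.eq_univ_of_forall fun s => by simp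
  have key : ∀ Z : S → ℝ, Integrable Z ν →
      HasSum (fun i => ∫ s in {s | H s = i}, Z s ∂ν) (∫ s, Z s ∂ν) := fun Z hZ => by
    have := hasSum_integral_iUnion (f := Z) hm hd hZ.integrableOn
    rwa [hU, setIntegral_univ] at this
  refine hasSum_le (fun i => ?_) (key X hX) (key Y hY)
  by_cases hi : ∃ s₀, H s₀ = i
  · obtain ⟨s₀, rfl⟩ := hi
    exact h s₀
  · have : {s | H s = i} = ∅ := Set.eq_empty_of_forall_notMem fun s hs => hi ⟨s, hs⟩
    rw [this]
    simp

lemma integral_comp_eq_sum [Fintype ι] {ν : Measure S} [IsFiniteMeasure ν] {Z : S → ι}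
    (hZ : Measurable Z) (φ : ι → ℝ) :
    ∫ s, φ (Z s) ∂ν = ∑ y, ν.real {s | Z s = y} * φ y := by
  rw [← integral_map (f := φ) hZ.aemeasurable (measurable_of_countable φ).aestronglyMeasurable,
    integral_fintype Integrable.of_finite]
  refine Finset.sum_congr rfl fun y _ => ?_
  rw [map_measureReal_apply hZ (measurableSet_singleton y), smul_eq_mul]
  rfl

end Discrete

/-! ### Correlations along a Markov chain -/

section Chain

variable {S Ω : Type*} [MeasurableSpace S] [MeasurableSpace Ω] {ν : Measure S}
  {P : Matrix Ω Ω ℝ} {z : ℕ → S → Ω}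

lemma IsMarkovChain.measurable_prefix (hz : IsMarkovChain ν P z) (n : ℕ) :
    Measurable fun s => fun i : Fin n => z i s :=
  measurable_pi_lambda _ fun i => hz.measurable i

variable [MeasurableSingletonClass Ω]

lemma IsMarkovChain.measurableSet_eq (hz : IsMarkovChain ν P z) (n : ℕ) (y : Ω) :
    MeasurableSet {s | z n s = y} :=
  hz.measurable n (measurableSet_singleton y)

lemma IsMarkovChain.measurableSet_lt (hz : IsMarkovChain ν P z) (x : ℕ → Ω) (n : ℕ) :
    MeasurableSet {s | ∀ i < n, z i s = x i} := by
  simp only [Set.ofPred_forall]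
  exact MeasurableSet.iInter fun i => MeasurableSet.iInter fun _ =>
    hz.measurable i (measurableSet_singleton _)

lemma IsMarkovChain.measurableSet_le (hz : IsMarkovChain ν P z) (x : ℕ → Ω) (n : ℕ) :
    MeasurableSet {s | ∀ i ≤ n, z i s = x i} := by
  simpa only [Nat.lt_succ_iff] using hz.measurableSet_lt x (n + 1)

/-- The Markov property: restricted to the event that the first `n` samples take given values, the
remaining samples again form a Markov chain with the same transition matrix. -/
lemma IsMarkovChain.restrict_shift (hz : IsMarkovChain ν P z) (n : ℕ) (x : ℕ → Ω) :
    IsMarkovChain (ν.restrict {s | ∀ i < n, z i s = x i}) P fun i => z (n + i) where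
  measurable i := hz.measurable _
  step m y := by
    have hB := hz.measurableSet_lt x n
    set w : ℕ → Ω := fun i => if i < n then x i else y (i - n) with hw
    have key : ∀ k, {s | ∀ i ≤ k, z (n + i) s = y i} ∩ {s | ∀ i < n, z i s = x i} =
        {s | ∀ i ≤ n + k, z i s = w i} := fun k => by
      ext s
      constructor
      · rintro ⟨h1, h2⟩ i hi
        by_cases hin : i < n
        · simp only [hw, if_pos hin]
          exact h2 i hin
        · simp only [hw, if_neg hin]
          have := h1 (i - n) (by omega)
          rwa [Nat.add_sub_cancel' (by omega)] at this
      · intro h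
        refine ⟨fun i hi => ?_, fun i hi => ?_⟩
        · have := h (n + i) (by omega)
          simpa [hw] using this
        · have := h i (by omega)
          simpa [hw, hi] using this
    have hm : ∀ k, MeasurableSet {s | ∀ i ≤ k, z (n + i) s = y i} := fun k => by
      simp only [Set.ofPred_forall]
      exact MeasurableSet.iInter fun i => MeasurableSet.iInter fun _ =>
        hz.measurable _ (measurableSet_singleton _)
    rw [measureReal_restrict_apply (hm _), measureReal_restrict_apply (hm _), key, key,
      ← add_assoc, hz.step]
    congr 2 <;> simp [hw]
    all_goals (try (rw [if_neg (by omega)]; congr 1; omega))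

variable [Fintype Ω] [DecidableEq Ω]

/-- The law of the sample `m` steps after a given initial segment. -/
lemma IsMarkovChain.real_prefix_inter [IsFiniteMeasure ν] (hz : IsMarkovChain ν P z) (m i : ℕ)
    (u : ℕ → Ω) (y : Ω) :
    ν.real ({s | ∀ k ≤ i, z k s = u k} ∩ {s | z (i + m) s = y}) =
      ν.real {s | ∀ k ≤ i, z k s = u k} * (P ^ m) (u i) y := by
  induction m generalizing i u with
  | zero =>
    by_cases h : u i = y
    · have : {s | ∀ k ≤ i, z k s = u k} ⊆ {s | z (i + 0) s = y} := fun s hs =>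
        (hs i le_rfl).trans h
      rw [Set.inter_eq_left.2 this]
      simp [h]
    · have : {s | ∀ k ≤ i, z k s = u k} ∩ {s | z (i + 0) s = y} = ∅ :=
        Set.eq_empty_of_forall_notMem fun s hs => h ((hs.1 i le_rfl).symm.trans hs.2)
      rw [this]
      simp [h]
  | succ m ih =>
    have hA := hz.measurableSet_le u i
    have hu : ∀ v k, k ≤ i → Function.update u (i + 1) v k = u k := fun v k hk =>
      Function.update_of_ne (by omega) _ _
    have hcell : ∀ v, {s | ∀ k ≤ i + 1, z k s = Function.update u (i + 1) v k} =
        {s | ∀ k ≤ i, z k s = u k} ∩ {s | z (i + 1) s = v} := fun v => by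
      ext s
      constructor
      · intro h
        refine ⟨fun k hk => ?_, ?_⟩
        · rw [h k (by omega), hu v k hk]
        · have := h (i + 1) le_rfl
          simpa using this
      · rintro ⟨h1, h2⟩ k hk
        rcases Nat.lt_or_ge i k with hik | hik
        · obtain rfl : k = i + 1 := by omega
          simpa using h2
        · rw [hu v k hik]
          exact h1 k hik
    set B := {s | ∀ k ≤ i, z k s = u k} ∩ {s | z (i + (m + 1)) s = y} with hB
    have hBm : MeasurableSet B := hA.inter (hz.measurable _ (measurableSet_singleton _))
    have hsum : ν.real B = ∑ v, ν.real (B ∩ {s | z (i + 1) s = v}) := by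
      have := integral_comp_eq_sum (ν := ν.restrict B) (hz.measurable (i + 1)) fun _ => (1 : ℝ)
      simp only [integral_const, smul_eq_mul, mul_one, measureReal_restrict_apply_univ] at this
      rw [this]
      refine Finset.sum_congr rfl fun v _ => ?_
      rw [measureReal_restrict_apply (hz.measurableSet_eq _ v),
        Set.inter_comm]
    have hterm : ∀ v, ν.real (B ∩ {s | z (i + 1) s = v}) =
        ν.real {s | ∀ k ≤ i, z k s = u k} * (P (u i) v * (P ^ m) v y) := fun v => by
      have h1 := ih (i + 1) (Function.update u (i + 1) v)
      have h2 := hz.step i (Function.update u (i + 1) v)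
      have h3 : {s | ∀ k ≤ i, z k s = Function.update u (i + 1) v k} =
          {s | ∀ k ≤ i, z k s = u k} := by
        ext s
        exact forall₂_congr fun k hk => by rw [hu v k hk]
      rw [h3, hu v i le_rfl, Function.update_self] at h2
      rw [h2, Function.update_self, hcell] at h1
      have h4 : B ∩ {s | z (i + 1) s = v} = {s | ∀ k ≤ i, z k s = u k} ∩
          {s | z (i + 1) s = v} ∩ {s | z (i + 1 + m) s = y} := by
        rw [hB, show i + (m + 1) = i + 1 + m by ring]
        exact Set.inter_right_comm _ _ _
      rw [h4, h1, mul_assoc]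
    rw [hsum, Finset.sum_congr rfl fun v _ => hterm v, ← Finset.mul_sum, pow_succ',
      Matrix.mul_apply]

variable {E : Type*} [NormedAddCommGroup E] [InnerProductSpace ℝ E]

/-- Correlations along the chain are controlled by the conditional means. -/
lemma IsMarkovChain.integral_inner_le [IsFiniteMeasure ν] (hz : IsMarkovChain ν P z) {a : Ω → E}
    {b c : ℝ} {m : ℕ} (hb : ∀ x, ‖a x‖ ≤ b) (hc : ∀ x, ‖∑ y, (P ^ m) x y • a y‖ ≤ c) (i : ℕ) :
    ∫ s, inner ℝ (a (z i s)) (a (z (i + m) s)) ∂ν ≤ b * c * ν.real Set.univ := by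
  have hint : Integrable (fun s => inner ℝ (a (z i s)) (a (z (i + m) s))) ν :=
    integrable_comp_of_countable ((hz.measurable i).prodMk (hz.measurable (i + m)))
      (fun p => inner ℝ (a p.1) (a p.2)) (c := b * b) fun s =>
      (abs_real_inner_le_norm _ _).trans (mul_le_mul (hb _) (hb _) (norm_nonneg _)
        ((norm_nonneg _).trans (hb (z i s))))
  have e : b * c * ν.real Set.univ = ∫ _, b * c ∂ν := by simp [mul_comm]
  rw [e]
  refine integral_le_integral_of_fibers (hz.measurable_prefix (i + 1)) hint
    (integrable_const _) fun s₀ => ?_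
  have hcell : {s | (fun k : Fin (i + 1) => z k s) = fun k : Fin (i + 1) => z k s₀} =
      {s | ∀ k ≤ i, z k s = z k s₀} := by
    ext s
    constructor
    · intro h k hk
      exact congrFun h ⟨k, by omega⟩
    · intro h
      funext k
      exact h k (by omega)
  rw [hcell]
  set A := {s | ∀ k ≤ i, z k s = z k s₀}
  have hA : MeasurableSet A := hz.measurableSet_le (fun k => z k s₀) i
  calc ∫ s in A, inner ℝ (a (z i s)) (a (z (i + m) s)) ∂ν
      = ∫ s in A, inner ℝ (a (z i s₀)) (a (z (i + m) s)) ∂ν :=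
        setIntegral_congr_fun hA fun s hs => by simp only [hs i le_rfl]
    _ = ∑ y, (ν.restrict A).real {s | z (i + m) s = y} * inner ℝ (a (z i s₀)) (a y) :=
        integral_comp_eq_sum (hz.measurable (i + m)) fun y => inner ℝ (a (z i s₀)) (a y)
    _ = ν.real A * inner ℝ (a (z i s₀)) (∑ y, (P ^ m) (z i s₀) y • a y) := by
        rw [inner_sum, Finset.mul_sum]
        refine Finset.sum_congr rfl fun y _ => ?_
        rw [measureReal_restrict_apply (hz.measurableSet_eq _ y),
          Set.inter_comm, hz.real_prefix_inter m i (fun k => z k s₀) y, inner_smul_right]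
        ring
    _ ≤ ν.real A * (b * c) := by
        refine mul_le_mul_of_nonneg_left ?_ measureReal_nonneg
        exact (real_inner_le_norm _ _).trans (mul_le_mul (hb _) (hc _) (norm_nonneg _)
          ((norm_nonneg _).trans (hb (z i s₀))))
    _ = ∫ _ in A, b * c ∂ν := by simp

/-- A row sum of a matrix whose `(i, k)` entry is at most `c |i - k|`. -/
lemma sum_range_le_of_symm {c : ℕ → ℝ} (hc : ∀ m, 0 ≤ c m) {N i : ℕ} (hi : i < N)
    {a : ℕ → ℝ} (h1 : ∀ k < i, a k ≤ c (i - k)) (h2 : ∀ k, a (i + k) ≤ c k) :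
    ∑ k ∈ Finset.range N, a k ≤ 2 * ∑ m ∈ Finset.range N, c m := by
  have hmono : ∀ n ≤ N, ∑ m ∈ Finset.range n, c m ≤ ∑ m ∈ Finset.range N, c m := fun n hn =>
    Finset.sum_le_sum_of_subset_of_nonneg (Finset.range_subset_range.2 hn) fun _ _ _ => hc _
  have e : N = i + (N - i) := by omega
  have h3 : ∑ k ∈ Finset.range i, a k ≤ ∑ m ∈ Finset.range (i + 1), c m := by
    rw [Finset.sum_range_succ']
    refine (Finset.sum_le_sum (g := fun k => c (i - 1 - k + 1)) fun k hk => ?_).trans ?_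
    · have hk' := Finset.mem_range.1 hk
      rw [show i - 1 - k + 1 = i - k by omega]
      exact h1 k hk'
    · rw [Finset.sum_range_reflect (fun k => c (k + 1)) i]
      linarith [hc 0]
  have h4 : ∑ k ∈ Finset.range N, a k =
      ∑ k ∈ Finset.range i, a k + ∑ k ∈ Finset.range (N - i), a (i + k) := by
    conv_lhs => rw [e, Finset.sum_range_add]
  have h5 : ∑ k ∈ Finset.range (N - i), a (i + k) ≤ ∑ m ∈ Finset.range (N - i), c m :=
    Finset.sum_le_sum fun k _ => h2 k
  have := hmono (i + 1) hi
  have := hmono (N - i) (by omega)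
  linarith

/-- A sum of `N` centered observables has second moment of order `N`, up to the mixing time. -/
lemma IsMarkovChain.integral_norm_sum_sq_le [IsFiniteMeasure ν] (hz : IsMarkovChain ν P z)
    {a : Ω → E} {b : ℝ} {c : ℕ → ℝ} (hb : ∀ x, ‖a x‖ ≤ b)
    (hc : ∀ m x, ‖∑ y, (P ^ m) x y • a y‖ ≤ c m) (N : ℕ) :
    ∫ s, ‖∑ i ∈ Finset.range N, a (z i s)‖ ^ 2 ∂ν ≤
      N * (2 * ∑ m ∈ Finset.range N, b * c m * ν.real Set.univ) := by
  rcases isEmpty_or_nonempty Ω with hΩ | ⟨⟨x₀⟩⟩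
  · have : IsEmpty S := ⟨fun s => hΩ.elim (z 0 s)⟩
    have h0 : ν = 0 := Measure.eq_zero_of_isEmpty ν
    simp [h0]
  have hb0 : 0 ≤ b := (norm_nonneg _).trans (hb x₀)
  have hc0 : ∀ m, 0 ≤ c m := fun m => (norm_nonneg _).trans (hc m x₀)
  have hint : ∀ i k, Integrable (fun s => inner ℝ (a (z i s)) (a (z k s))) ν := fun i k =>
    integrable_comp_of_countable ((hz.measurable i).prodMk (hz.measurable k))
      (fun p => inner ℝ (a p.1) (a p.2)) (c := b * b) fun s =>
      (abs_real_inner_le_norm _ _).trans (mul_le_mul (hb _) (hb _) (norm_nonneg _) hb0)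
  have e : ∀ s, ‖∑ i ∈ Finset.range N, a (z i s)‖ ^ 2 =
      ∑ i ∈ Finset.range N, ∑ k ∈ Finset.range N, inner ℝ (a (z i s)) (a (z k s)) := fun s => by
    rw [← real_inner_self_eq_norm_sq, sum_inner]
    simp only [inner_sum]
  simp only [e]
  rw [integral_finsetSum _ fun i _ => integrable_finsetSum _ fun k _ => hint i k]
  simp only [integral_finsetSum _ fun k _ => hint _ k]
  refine (Finset.sum_le_card_nsmul _ _ _ fun i hi => ?_).trans_eq
    (by rw [Finset.card_range, nsmul_eq_mul])
  refine sum_range_le_of_symm (c := fun m => b * c m * ν.real Set.univ)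
    (fun m => by have := hc0 m; positivity) (Finset.mem_range.1 hi) (fun k hk => ?_) fun k => ?_
  · have := hz.integral_inner_le hb (hc (i - k)) k
    rw [Nat.add_sub_cancel' hk.le] at this
    simpa only [real_inner_comm] using this
  · exact hz.integral_inner_le hb (hc k) i

/-- Mean squared error of a batch of `2 ^ j` consecutive stochastic gradients, started anywhere. -/
lemma IsMarkovChain.integral_batchGrad_sub_sq_le [IsFiniteMeasure ν] (hz : IsMarkovChain ν P z)
    (hP : IsErgodic P) {μ : Ω → ℝ} (hμ : IsStationary P μ) {gradf : E → Ω → E} {w : E} {G : ℝ}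
    (hG : ∀ x, ‖gradf w x‖ ≤ G) (j : ℕ) :
    ∫ s, ‖batchGrad gradf w (fun i => z i s) j - meanGrad μ gradf w‖ ^ 2 ∂ν ≤
      16 * G ^ 2 * tauMix P μ / 2 ^ j * ν.real Set.univ := by
  obtain ⟨x₀⟩ := hμ.nonempty
  have hG0 : 0 ≤ G := (norm_nonneg _).trans (hG x₀)
  set τ := tauMix P μ
  have hτ : 1 ≤ τ := (tauMix_spec hP hμ).1
  set a : Ω → E := fun x => gradf w x - meanGrad μ gradf w with ha
  have hb : ∀ x, ‖a x‖ ≤ 2 * G := fun x => by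
    have := norm_sub_le (gradf w x) (meanGrad μ gradf w)
    have := norm_meanGrad_le hμ.prob hG
    have := hG x
    linarith
  have hc : ∀ m x, ‖∑ y, (P ^ m) x y • a y‖ ≤ 2 * G * (1 / 2 : ℝ) ^ (m / τ) := fun m x => by
    have e : ∑ y, (P ^ m) x y • a y = ∑ y, ((P ^ m) x y - μ y) • gradf w y := by
      simp only [ha, smul_sub, sub_smul, Finset.sum_sub_distrib, ← Finset.sum_smul,
        Matrix.sum_row_of_mem_rowStochastic (pow_mem hP.stochastic m), one_smul]
      rfl
    rw [e]
    refine (norm_sum_le _ _).trans ?_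
    calc ∑ y, ‖((P ^ m) x y - μ y) • gradf w y‖ ≤ ∑ y, |(P ^ m) x y - μ y| * G :=
          Finset.sum_le_sum fun y _ => by
            rw [norm_smul, Real.norm_eq_abs]
            exact mul_le_mul_of_nonneg_left (hG y) (abs_nonneg _)
      _ = (∑ y, |(P ^ m) x y - μ y|) * G := by rw [Finset.sum_mul]
      _ ≤ 2 * (1 / 2 : ℝ) ^ (m / τ) * G :=
          mul_le_mul_of_nonneg_right (sum_abs_pow_sub_le hP hμ x m) hG0
      _ = 2 * G * (1 / 2 : ℝ) ^ (m / τ) := by ring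
  have key := hz.integral_norm_sum_sq_le hb hc (2 ^ j)
  have h2 : (0 : ℝ) < 2 ^ j := by positivity
  have e : ∀ s, ‖batchGrad gradf w (fun i => z i s) j - meanGrad μ gradf w‖ ^ 2 =
      ((2 : ℝ) ^ j)⁻¹ ^ 2 * ‖∑ i ∈ Finset.range (2 ^ j), a (z i s)‖ ^ 2 := fun s => by
    have : batchGrad gradf w (fun i => z i s) j - meanGrad μ gradf w =
        ((2 : ℝ) ^ j)⁻¹ • ∑ i ∈ Finset.range (2 ^ j), a (z i s) := by
      simp only [batchGrad, ha, Finset.sum_sub_distrib, smul_sub, Finset.sum_const,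
        Finset.card_range]
      rw [← Nat.cast_smul_eq_nsmul ℝ, smul_smul]
      push_cast
      rw [inv_mul_cancel₀ h2.ne', one_smul]
    rw [this, norm_smul, mul_pow, Real.norm_of_nonneg (by positivity)]
  simp only [e]
  rw [integral_const_mul]
  have hsum : ∑ m ∈ Finset.range (2 ^ j), 2 * G * (2 * G * (1 / 2 : ℝ) ^ (m / τ)) * ν.real Set.univ
      ≤ 4 * G ^ 2 * ν.real Set.univ * (2 * τ) := by
    have e3 : ∀ m : ℕ, 2 * G * (2 * G * (1 / 2 : ℝ) ^ (m / τ)) * ν.real Set.univ =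
        4 * G ^ 2 * ν.real Set.univ * (1 / 2 : ℝ) ^ (m / τ) := fun m => by ring
    simp only [e3]
    rw [← Finset.mul_sum]
    exact mul_le_mul_of_nonneg_left (sum_range_half_pow_div_le hτ _) (by positivity)
  calc ((2 : ℝ) ^ j)⁻¹ ^ 2 * ∫ s, ‖∑ i ∈ Finset.range (2 ^ j), a (z i s)‖ ^ 2 ∂ν
      ≤ ((2 : ℝ) ^ j)⁻¹ ^ 2 * ((2 ^ j : ℕ) * (2 * (4 * G ^ 2 * ν.real Set.univ * (2 * τ)))) := by
        gcongr
        exact key.trans (by gcongr)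
    _ = 16 * G ^ 2 * τ / 2 ^ j * ν.real Set.univ := by
        push_cast
        field_simp
        ring

end Chain

/-! ### The multi-level estimator as a telescoping sum -/

section Telescoping

variable {E Ω : Type*} [NormedAddCommGroup E] [InnerProductSpace ℝ E]

lemma sum_range_ite_eq_succ {M : Type*} [AddCommMonoid M] (a : ℕ → M) (L j : ℕ) :
    ∑ i ∈ Finset.range L, (if j = i + 1 then a i else 0) =
      if 1 ≤ j ∧ j ≤ L then a (j - 1) else 0 := by
  cases j with
  | zero => simp
  | succ j => simp

lemma two_pow_le_iff_le_log {T : ℕ} (hT : 1 ≤ T) (j : ℕ) : 2 ^ j ≤ T ↔ j ≤ Nat.log 2 T :=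
  (Nat.le_log_iff_pow_le (by norm_num) (by omega)).symm

/-- The correction term as a sum over all admissible levels, of which at most one is active. Level
`0`, which has probability zero, contributes nothing. -/
lemma mlmcGrad_eq_add_sum {T : ℕ} (hT : 1 ≤ T) (gradf : E → Ω → E) (w : E) (x : ℕ → Ω) (j : ℕ) :
    mlmcGrad T gradf w x j = batchGrad gradf w x 0 + ∑ i ∈ Finset.range (Nat.log 2 T),
      if j = i + 1 then
        (2 : ℝ) ^ (i + 1) • (batchGrad gradf w x (i + 1) - batchGrad gradf w x i) else 0 := by
  rw [sum_range_ite_eq_succ, mlmcGrad]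
  congr 1
  simp only [two_pow_le_iff_le_log hT]
  cases j with
  | zero => simp
  | succ j => simp

lemma norm_mlmcGrad_sq_le {T : ℕ} (hT : 1 ≤ T) (gradf : E → Ω → E) (w : E) (x : ℕ → Ω) (j : ℕ) :
    ‖mlmcGrad T gradf w x j‖ ^ 2 ≤ 2 * ‖batchGrad gradf w x 0‖ ^ 2 +
      ∑ i ∈ Finset.range (Nat.log 2 T), if j = i + 1 then
        2 * 4 ^ (i + 1) * ‖batchGrad gradf w x (i + 1) - batchGrad gradf w x i‖ ^ 2 else 0 := by
  rw [mlmcGrad_eq_add_sum hT, sum_range_ite_eq_succ, sum_range_ite_eq_succ]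
  split_ifs with h
  · refine (pow_le_pow_left₀ (norm_nonneg _) (norm_add_le _ _) 2).trans ?_
    rw [norm_smul, Real.norm_of_nonneg (by positivity), show (4 : ℝ) = 2 ^ 2 by norm_num, ← pow_mul,
      mul_comm 2 (j - 1 + 1), pow_mul]
    nlinarith [sq_nonneg (‖batchGrad gradf w x 0‖ -
      2 ^ (j - 1 + 1) * ‖batchGrad gradf w x (j - 1 + 1) - batchGrad gradf w x (j - 1)‖)]
  · rw [add_zero, add_zero]
    nlinarith [sq_nonneg ‖batchGrad gradf w x 0‖]

lemma norm_batchGrad_le {gradf : E → Ω → E} {w : E} {G : ℝ} (hG : ∀ x, ‖gradf w x‖ ≤ G)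
    (x : ℕ → Ω) (j : ℕ) : ‖batchGrad gradf w x j‖ ≤ G := by
  have h2 : (0 : ℝ) < 2 ^ j := by positivity
  have h := norm_sum_le_of_le (Finset.range (2 ^ j)) (f := fun i => gradf w (x i)) fun i _ =>
    hG (x i)
  rw [Finset.sum_const, Finset.card_range, nsmul_eq_mul] at h
  rw [batchGrad, norm_smul, Real.norm_of_nonneg (by positivity), inv_mul_le_iff₀ h2]
  exact_mod_cast h

lemma norm_mlmcGrad_le {T : ℕ} {gradf : E → Ω → E} {w : E} {G : ℝ}
    (hG : ∀ x, ‖gradf w x‖ ≤ G) (x : ℕ → Ω) (j : ℕ) :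
    ‖mlmcGrad T gradf w x j‖ ≤ G + T * (2 * G) := by
  have hb := norm_batchGrad_le hG x
  have hG0 : 0 ≤ G := (norm_nonneg _).trans (hb 0)
  rw [mlmcGrad]
  refine (norm_add_le _ _).trans (add_le_add (hb 0) ?_)
  split_ifs with h
  · rw [norm_smul, Real.norm_of_nonneg (by positivity)]
    refine mul_le_mul (by exact_mod_cast h) ?_ (norm_nonneg _) (by positivity)
    have := norm_sub_le (batchGrad gradf w x j) (batchGrad gradf w x (j - 1))
    linarith [hb j, hb (j - 1)]
  · rw [norm_zero]
    positivity

lemma numSamples_le_add_sum {T : ℕ} (hT : 1 ≤ T) (j : ℕ) :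
    (numSamples T j : ℝ) ≤ 1 + ∑ i ∈ Finset.range (Nat.log 2 T),
      if j = i + 1 then (2 : ℝ) ^ (i + 1) else 0 := by
  rw [sum_range_ite_eq_succ, numSamples]
  simp only [two_pow_le_iff_le_log hT]
  cases j with
  | zero => simp
  | succ j =>
    split_ifs with h1 h2 h2
    · simp
    · exact absurd ⟨by omega, h1⟩ h2
    · exact absurd h2.2 h1
    · simp

lemma measurable_batchGrad_shift [MeasurableSpace E] [BorelSpace E] [SecondCountableTopology E]
    [MeasurableSpace Ω] [MeasurableSingletonClass Ω] [Countable Ω] (gradf : E → Ω → E) (w : E)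
    (n j : ℕ) : Measurable fun x : ℕ → Ω => batchGrad gradf w (fun i => x (n + i)) j := by
  unfold batchGrad
  refine Measurable.const_smul (Finset.measurable_sum _ fun i _ => ?_) _
  exact (measurable_of_countable (gradf w)).comp (measurable_pi_apply (n + i))

end Telescoping

/-! ### One iteration, conditionally on the past -/

section OneStep

variable {S Ω : Type*} [MeasurableSpace S] {Pr : Measure S} {J : ℕ → S → ℕ}

lemma measurableSet_forall_lt_eq {α : Type*} [MeasurableSpace α] [MeasurableSingletonClass α]
    (y : ℕ → α) (n : ℕ) : MeasurableSet {x : ℕ → α | ∀ i < n, x i = y i} := by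
  simp only [Set.ofPred_forall]
  exact MeasurableSet.iInter fun i => MeasurableSet.iInter fun _ =>
    measurable_pi_apply i (measurableSet_singleton _)

lemma IsGeomLevels.measurableSet_lt (hJ : IsGeomLevels Pr J) (j : ℕ → ℕ) (t : ℕ) :
    MeasurableSet {s | ∀ k < t, J k s = j k} := by
  simp only [Set.ofPred_forall]
  exact MeasurableSet.iInter fun i => MeasurableSet.iInter fun _ =>
    hJ.measurable i (measurableSet_singleton _)

lemma IsGeomLevels.real_lt_inter (hJ : IsGeomLevels Pr J) (j : ℕ → ℕ) (t : ℕ) {l : ℕ} (hl : 1 ≤ l) :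
    Pr.real {s | (∀ k < t, J k s = j k) ∧ J t s = l} =
      Pr.real {s | ∀ k < t, J k s = j k} * (1 / 2) ^ l := by
  have hprod : ∀ (j : ℕ → ℕ) (t : ℕ), Pr.real {s | ∀ k < t, J k s = j k} =
      ∏ k ∈ Finset.range t, Pr.real {s | J k s = j k} := fun j t => by
    have h := hJ.indep.measure_inter_preimage_eq_mul (Finset.range t) (sets := fun k => {j k})
      fun k _ => measurableSet_singleton _
    have e : {s | ∀ k < t, J k s = j k} = ⋂ k ∈ Finset.range t, J k ⁻¹' {j k} := by
      ext s
      simp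
    rw [e, measureReal_def, h, ENNReal.toReal_prod]
    rfl
  have e : {s | (∀ k < t, J k s = j k) ∧ J t s = l} =
      {s | ∀ k < t + 1, J k s = Function.update j t l k} := by
    ext s
    constructor
    · rintro ⟨h1, h2⟩ k hk
      rcases Nat.lt_succ_iff_lt_or_eq.1 hk with h | rfl
      · rw [Function.update_of_ne (by omega)]
        exact h1 k h
      · simpa using h2
    · intro h
      refine ⟨fun k hk => ?_, ?_⟩
      · have := h k (by omega)
        rwa [Function.update_of_ne (by omega)] at this
      · simpa using h t (by omega)
  rw [e, hprod, hprod, Finset.prod_range_succ, Function.update_self, hJ.law t l hl]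
  congr 1
  refine Finset.prod_congr rfl fun k hk => ?_
  rw [Function.update_of_ne (by have := Finset.mem_range.1 hk; omega)]

variable [MeasurableSpace Ω] {P : Matrix Ω Ω ℝ} {z : ℕ → S → Ω} [MeasurableSingletonClass Ω]

/-- Independence of the levels and the samples, as a factorization of integrals. -/
lemma setIntegral_levels_inter_samples (hz : IsMarkovChain Pr P z) (hJ : IsGeomLevels Pr J)
    (hind : IndepFun (fun s n => z n s) (fun s t => J t s) Pr) {C : Set (ℕ → ℕ)}
    (hC : MeasurableSet C) (x : ℕ → Ω) (n : ℕ) {φ : (ℕ → Ω) → ℝ} (hφ : Measurable φ) :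
    ∫ s in {s | (fun t => J t s) ∈ C} ∩ {s | ∀ i < n, z i s = x i}, φ (fun i => z i s) ∂Pr =
      Pr.real {s | (fun t => J t s) ∈ C} *
        ∫ s in {s | ∀ i < n, z i s = x i}, φ (fun i => z i s) ∂Pr := by
  have hJm : Measurable fun s => fun t => J t s := measurable_pi_lambda _ hJ.measurable
  have hzm : Measurable fun s => fun i => z i s := measurable_pi_lambda _ hz.measurable
  have hA : MeasurableSet {s | (fun t => J t s) ∈ C} := hJm hC
  have hB := hz.measurableSet_lt x n
  set B' : Set (ℕ → Ω) := {y | ∀ i < n, y i = x i}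
  have hB' : MeasurableSet B' := measurableSet_forall_lt_eq x n
  have h1 : Measurable (C.indicator fun _ => (1 : ℝ)) := measurable_const.indicator hC
  have h2 : Measurable (B'.indicator φ) := hφ.indicator hB'
  have h3 := (hind.symm.comp h1 h2).integral_mul_eq_mul_integral
    (h1.comp hJm).aestronglyMeasurable (h2.comp hzm).aestronglyMeasurable
  have e1 : Pr.real {s | (fun t => J t s) ∈ C} =
      ∫ s, ((C.indicator fun _ => (1 : ℝ)) ∘ fun s t => J t s) s ∂Pr := by
    have : ((C.indicator fun _ => (1 : ℝ)) ∘ fun s t => J t s) =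
        {s | (fun t => J t s) ∈ C}.indicator fun _ => (1 : ℝ) := by
      ext s
      simp [Set.indicator]
    rw [this, integral_indicator_const _ hA]
    simp
  have e2 : ∫ s in {s | ∀ i < n, z i s = x i}, φ (fun i => z i s) ∂Pr =
      ∫ s, (B'.indicator φ ∘ fun s n => z n s) s ∂Pr := by
    rw [← integral_indicator hB]
    congr 1
  rw [e1, e2, ← h3, ← integral_indicator (hA.inter hB)]
  congr 1
  ext s
  simp only [Pi.mul_apply, Function.comp]
  by_cases ha : (fun t => J t s) ∈ C
  · rw [Set.indicator_of_mem ha, one_mul]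
    by_cases hb : (fun i => z i s) ∈ B'
    · rw [Set.indicator_of_mem hb]
      exact Set.indicator_of_mem (show s ∈ {s | (fun t => J t s) ∈ C} ∩ _ from ⟨ha, hb⟩) _
    · rw [Set.indicator_of_notMem hb]
      exact Set.indicator_of_notMem (fun h => hb h.2) _
  · rw [Set.indicator_of_notMem ha, zero_mul]
    exact Set.indicator_of_notMem (fun h => ha h.1) _

lemma setIntegral_past (hz : IsMarkovChain Pr P z) (hJ : IsGeomLevels Pr J)
    (hind : IndepFun (fun s n => z n s) (fun s t => J t s) Pr) (j : ℕ → ℕ) (t : ℕ)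
    (x : ℕ → Ω) (n : ℕ) {φ : (ℕ → Ω) → ℝ} (hφ : Measurable φ) :
    ∫ s in {s | ∀ k < t, J k s = j k} ∩ {s | ∀ i < n, z i s = x i}, φ (fun i => z i s) ∂Pr =
      Pr.real {s | ∀ k < t, J k s = j k} *
        ∫ s in {s | ∀ i < n, z i s = x i}, φ (fun i => z i s) ∂Pr :=
  setIntegral_levels_inter_samples hz hJ hind (measurableSet_forall_lt_eq j t) x n hφ

lemma real_past (hz : IsMarkovChain Pr P z) (hJ : IsGeomLevels Pr J)
    (hind : IndepFun (fun s n => z n s) (fun s t => J t s) Pr) (j : ℕ → ℕ) (t : ℕ)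
    (x : ℕ → Ω) (n : ℕ) :
    Pr.real ({s | ∀ k < t, J k s = j k} ∩ {s | ∀ i < n, z i s = x i}) =
      Pr.real {s | ∀ k < t, J k s = j k} * Pr.real {s | ∀ i < n, z i s = x i} := by
  have := setIntegral_past hz hJ hind j t x n (φ := fun _ => 1) measurable_const
  simpa using this

/-- Given the past, a fresh level `l` is drawn with probability `2 ^ (-l)`, independently of the
samples. -/
lemma setIntegral_past_ite (hz : IsMarkovChain Pr P z) (hJ : IsGeomLevels Pr J)
    (hind : IndepFun (fun s n => z n s) (fun s t => J t s) Pr) (j : ℕ → ℕ) (t : ℕ)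
    (x : ℕ → Ω) (n : ℕ) {φ : (ℕ → Ω) → ℝ} (hφ : Measurable φ) {l : ℕ} (hl : 1 ≤ l) :
    ∫ s in {s | ∀ k < t, J k s = j k} ∩ {s | ∀ i < n, z i s = x i},
        (if J t s = l then φ (fun i => z i s) else 0) ∂Pr =
      Pr.real {s | ∀ k < t, J k s = j k} * ((1 / 2) ^ l *
        ∫ s in {s | ∀ i < n, z i s = x i}, φ (fun i => z i s) ∂Pr) := by
  have hl' : MeasurableSet {s | J t s = l} := hJ.measurable t (measurableSet_singleton l)
  have e : ∀ s, (if J t s = l then φ (fun i => z i s) else 0) =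
      {s | J t s = l}.indicator (fun s => φ fun i => z i s) s := fun s => by
    simp [Set.indicator]
  simp only [e]
  rw [setIntegral_indicator hl', ← mul_assoc, ← hJ.real_lt_inter j t hl]
  have h := setIntegral_levels_inter_samples (C := {y | (∀ k < t, y k = j k) ∧ y t = l})
    hz hJ hind (by
      have ht : MeasurableSet {y : ℕ → ℕ | y t = l} :=
        measurableSet_eq_fun (measurable_pi_apply t) measurable_const
      exact (measurableSet_forall_lt_eq j t).inter ht) x n hφ
  have e2 : {s | ∀ k < t, J k s = j k} ∩ {s | ∀ i < n, z i s = x i} ∩ {s | J t s = l} =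
      {s | (∀ k < t, J k s = j k) ∧ J t s = l} ∩ {s | ∀ i < n, z i s = x i} :=
    Set.inter_right_comm _ _ _
  rw [e2]
  exact h

variable [IsProbabilityMeasure Pr]

/-- An upper bound for the mean, given the past of iteration `t`, bounds the overall mean. The past
is the sequence of earlier levels together with the samples which these levels consume. -/
lemma integral_le_of_past [Finite Ω] (hz : IsMarkovChain Pr P z) (hJ : IsGeomLevels Pr J)
    {X : S → ℝ} (hX : Integrable X Pr) {c : ℝ} (T t : ℕ)
    (h : ∀ (j : ℕ → ℕ) (x : ℕ → Ω),
      ∫ s in {s | ∀ k < t, J k s = j k} ∩ {s | ∀ i < totalSamples T j t, z i s = x i}, X s ∂Pr ≤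
      c * Pr.real ({s | ∀ k < t, J k s = j k} ∩ {s | ∀ i < totalSamples T j t, z i s = x i})) :
    ∫ s, X s ∂Pr ≤ c := by
  have e : c = ∫ _, c ∂Pr := by simp
  rw [e]
  refine integral_le_integral_of_fibers (H := fun s => fun k : Fin t => J k s)
    (measurable_pi_lambda _ fun k => hJ.measurable k) hX (integrable_const _) fun s₀ => ?_
  set j : ℕ → ℕ := fun k => J k s₀
  have hA : {s | (fun k : Fin t => J k s) = fun k : Fin t => J k s₀} =
      {s | ∀ k < t, J k s = j k} := by
    ext s
    exact ⟨fun h k hk => congrFun h ⟨k, hk⟩, fun h => funext fun k => h k k.2⟩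
  rw [hA]
  refine integral_le_integral_of_fibers (hz.measurable_prefix (totalSamples T j t)) hX.restrict
    (integrable_const _) fun s₁ => ?_
  have hB : {s | (fun i : Fin (totalSamples T j t) => z i s) =
      fun i : Fin (totalSamples T j t) => z i s₁} =
      {s | ∀ i < totalSamples T j t, z i s = z i s₁} := by
    ext s
    exact ⟨fun h k hk => congrFun h ⟨k, hk⟩, fun h => funext fun k => h k k.2⟩
  rw [hB, Measure.restrict_restrict (hz.measurableSet_lt (fun i => z i s₁) _), Set.inter_comm]
  refine (h j fun i => z i s₁).trans_eq ?_
  simp [mul_comm]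

variable [Fintype Ω] [DecidableEq Ω]
variable {E : Type*} [NormedAddCommGroup E] [InnerProductSpace ℝ E] [MeasurableSpace E]
  [BorelSpace E] [SecondCountableTopology E]

/-- Conditional second moment of the gradient estimate: each of the `log₂ T` levels contributes
`O(G² τ)`, since the weight `4 ^ l` is balanced by the probability `2 ^ (-l)` of the level and the
variance `O(2 ^ (-l))` of its batches. -/
lemma setIntegral_norm_mlmcGrad_sq_le (hP : IsErgodic P) {μ : Ω → ℝ} (hμ : IsStationary P μ)
    (hz : IsMarkovChain Pr P z) (hJ : IsGeomLevels Pr J)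
    (hind : IndepFun (fun s n => z n s) (fun s t => J t s) Pr) {gradf : E → Ω → E} {w : E}
    {G : ℝ} (hG : ∀ x, ‖gradf w x‖ ≤ G) {T : ℕ} (hT : 1 ≤ T) (j : ℕ → ℕ) (t : ℕ) (x : ℕ → Ω)
    (n : ℕ) :
    ∫ s in {s | ∀ k < t, J k s = j k} ∩ {s | ∀ i < n, z i s = x i},
        ‖mlmcGrad T gradf w (fun i => z (n + i) s) (J t s)‖ ^ 2 ∂Pr ≤
      (2 * G ^ 2 + 192 * Nat.log 2 T * (G ^ 2 * tauMix P μ)) *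
        Pr.real ({s | ∀ k < t, J k s = j k} ∩ {s | ∀ i < n, z i s = x i}) := by
  set A := {s | ∀ k < t, J k s = j k} with hA
  set B := {s | ∀ i < n, z i s = x i} with hB
  have hzm : Measurable fun s => fun i => z i s := measurable_pi_lambda _ hz.measurable
  have hbm := measurable_batchGrad_shift gradf w n
  set b : ℕ → S → E := fun l s => batchGrad gradf w (fun i => z (n + i) s) l with hb
  have hbmeas : ∀ l, Measurable (b l) := fun l => (hbm l).comp hzm
  have hbG : ∀ l s, ‖b l s‖ ≤ G := fun l s => norm_batchGrad_le hG _ l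
  have hG0 : 0 ≤ G := (norm_nonneg _).trans (hG (x 0))
  have hint : ∀ (i : ℕ) (ν : Measure S) [IsFiniteMeasure ν],
      Integrable (fun s => ‖b (i + 1) s - b i s‖ ^ 2) ν := fun i ν _ => by
    refine Integrable.of_bound (((hbmeas _).sub (hbmeas _)).norm.pow_const 2).aestronglyMeasurable
      ((2 * G) ^ 2) (Filter.Eventually.of_forall fun s => ?_)
    rw [Real.norm_of_nonneg (by positivity)]
    have := norm_sub_le (b (i + 1) s) (b i s)
    gcongr
    linarith [hbG (i + 1) s, hbG i s]
  have hint2 : ∀ (l : ℕ) (ν : Measure S) [IsFiniteMeasure ν],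
      Integrable (fun s => ‖b l s - meanGrad μ gradf w‖ ^ 2) ν := fun l ν _ => by
    refine Integrable.of_bound (((hbmeas _).sub_const _).norm.pow_const 2).aestronglyMeasurable
      ((2 * G) ^ 2) (Filter.Eventually.of_forall fun s => ?_)
    rw [Real.norm_of_nonneg (by positivity)]
    have := norm_sub_le (b l s) (meanGrad μ gradf w)
    gcongr
    linarith [hbG l s, norm_meanGrad_le hμ.prob hG]
  set V := 16 * G ^ 2 * (tauMix P μ : ℝ)
  have hvar : ∀ l, ∫ s in B, ‖b l s - meanGrad μ gradf w‖ ^ 2 ∂Pr ≤ V / 2 ^ l * Pr.real B :=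
    fun l => by
      have := (hz.restrict_shift n x).integral_batchGrad_sub_sq_le hP hμ hG l
      rwa [measureReal_restrict_apply_univ] at this
  have hdiff : ∀ i, ∫ s in B, ‖b (i + 1) s - b i s‖ ^ 2 ∂Pr ≤ 6 * V / 2 ^ (i + 1) * Pr.real B :=
    fun i => by
      calc ∫ s in B, ‖b (i + 1) s - b i s‖ ^ 2 ∂Pr
          ≤ ∫ s in B, (2 * ‖b (i + 1) s - meanGrad μ gradf w‖ ^ 2 +
              2 * ‖b i s - meanGrad μ gradf w‖ ^ 2) ∂Pr := by
            refine integral_mono (hint i _) (((hint2 _ _).const_mul 2).add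
              ((hint2 _ _).const_mul 2)) fun s => ?_
            have h := norm_sub_le (b (i + 1) s - meanGrad μ gradf w) (b i s - meanGrad μ gradf w)
            rw [sub_sub_sub_cancel_right] at h
            have h' := pow_le_pow_left₀ (norm_nonneg _) h 2
            simp only
            nlinarith [sq_nonneg (‖b (i + 1) s - meanGrad μ gradf w‖ -
              ‖b i s - meanGrad μ gradf w‖)]
        _ = 2 * (∫ s in B, ‖b (i + 1) s - meanGrad μ gradf w‖ ^ 2 ∂Pr) +
              2 * ∫ s in B, ‖b i s - meanGrad μ gradf w‖ ^ 2 ∂Pr := by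
            rw [integral_add ((hint2 _ _).const_mul 2) ((hint2 _ _).const_mul 2),
              integral_const_mul, integral_const_mul]
        _ ≤ 2 * (V / 2 ^ (i + 1) * Pr.real B) + 2 * (V / 2 ^ i * Pr.real B) := by
            gcongr
            exacts [hvar _, hvar _]
        _ = 6 * V / 2 ^ (i + 1) * Pr.real B := by
            rw [pow_succ]
            field_simp
            ring
  have hlevel : ∀ i, ∫ s in A ∩ B, (if J t s = i + 1 then
      2 * 4 ^ (i + 1) * ‖b (i + 1) s - b i s‖ ^ 2 else 0) ∂Pr ≤ 12 * V * Pr.real (A ∩ B) :=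
    fun i => by
      have h := setIntegral_past_ite hz hJ hind j t x n (l := i + 1)
        (φ := fun y => 2 * 4 ^ (i + 1) * ‖batchGrad gradf w (fun k => y (n + k)) (i + 1) -
          batchGrad gradf w (fun k => y (n + k)) i‖ ^ 2)
        ((((hbm _).sub (hbm _)).norm.pow_const 2).const_mul _) (by omega)
      rw [h, real_past hz hJ hind, integral_const_mul]
      have h4 : (4 : ℝ) ^ (i + 1) = 2 ^ (i + 1) * 2 ^ (i + 1) := by
        rw [← mul_pow]; norm_num
      calc Pr.real A * ((1 / 2) ^ (i + 1) * (2 * 4 ^ (i + 1) *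
            ∫ s in B, ‖b (i + 1) s - b i s‖ ^ 2 ∂Pr))
          ≤ Pr.real A * ((1 / 2) ^ (i + 1) * (2 * 4 ^ (i + 1) *
            (6 * V / 2 ^ (i + 1) * Pr.real B))) := by
            gcongr
            exact hdiff i
        _ = 12 * V * (Pr.real A * Pr.real B) := by
            rw [h4, one_div, inv_pow]
            field_simp
            ring
  have hintl : ∀ i, Integrable (fun s => if J t s = i + 1 then
      2 * 4 ^ (i + 1) * ‖b (i + 1) s - b i s‖ ^ 2 else 0) (Pr.restrict (A ∩ B)) := fun i => by
    have := ((hint i (Pr.restrict (A ∩ B))).const_mul (2 * 4 ^ (i + 1))).indicator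
      (hJ.measurable t (measurableSet_singleton (i + 1)))
    refine this.congr (Filter.Eventually.of_forall fun s => ?_)
    simp [Set.indicator]
  calc ∫ s in A ∩ B, ‖mlmcGrad T gradf w (fun i => z (n + i) s) (J t s)‖ ^ 2 ∂Pr
      ≤ ∫ s in A ∩ B, (2 * G ^ 2 + ∑ i ∈ Finset.range (Nat.log 2 T), if J t s = i + 1 then
          2 * 4 ^ (i + 1) * ‖b (i + 1) s - b i s‖ ^ 2 else 0) ∂Pr := by
        refine integral_mono_of_nonneg (Filter.Eventually.of_forall fun s => by positivity)
          ((integrable_const _).add (integrable_finsetSum _ fun i _ => hintl i))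
          (Filter.Eventually.of_forall fun s => ?_)
        refine (norm_mlmcGrad_sq_le hT gradf w _ _).trans ?_
        have := pow_le_pow_left₀ (norm_nonneg _) (hbG 0 s) 2
        exact add_le_add_left (by linarith) _
    _ = 2 * G ^ 2 * Pr.real (A ∩ B) + ∑ i ∈ Finset.range (Nat.log 2 T),
          ∫ s in A ∩ B, (if J t s = i + 1 then
            2 * 4 ^ (i + 1) * ‖b (i + 1) s - b i s‖ ^ 2 else 0) ∂Pr := by
        rw [integral_add (integrable_const _) (integrable_finsetSum _ fun i _ => hintl i),
          integral_finsetSum _ fun i _ => hintl i]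
        simp [mul_comm]
    _ ≤ 2 * G ^ 2 * Pr.real (A ∩ B) + ∑ i ∈ Finset.range (Nat.log 2 T),
          12 * V * Pr.real (A ∩ B) := by
        gcongr with i _
        exact hlevel i
    _ = (2 * G ^ 2 + 192 * Nat.log 2 T * (G ^ 2 * tauMix P μ)) * Pr.real (A ∩ B) := by
        rw [Finset.sum_const, Finset.card_range, nsmul_eq_mul]
        ring

/-- Conditional bias of the gradient estimate: its conditional mean is that of the largest
admissible batch, by telescoping over the levels, so the bias is at most the root mean squared
error of that batch. -/
lemma setIntegral_inner_meanGrad_sub_mlmcGrad_le (hP : IsErgodic P) {μ : Ω → ℝ}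
    (hμ : IsStationary P μ) (hz : IsMarkovChain Pr P z) (hJ : IsGeomLevels Pr J)
    (hind : IndepFun (fun s n => z n s) (fun s t => J t s) Pr) {gradf : E → Ω → E} {w : E}
    {G : ℝ} (hG0 : 0 < G) (hG : ∀ x, ‖gradf w x‖ ≤ G) {T : ℕ} (hT : 1 ≤ T) (j : ℕ → ℕ) (t : ℕ)
    (x : ℕ → Ω) (n : ℕ) (v : E) :
    ∫ s in {s | ∀ k < t, J k s = j k} ∩ {s | ∀ i < n, z i s = x i},
        inner ℝ (meanGrad μ gradf w - mlmcGrad T gradf w (fun i => z (n + i) s) (J t s)) v ∂Pr ≤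
      ‖v‖ * √(16 * G ^ 2 * tauMix P μ / 2 ^ Nat.log 2 T) *
        Pr.real ({s | ∀ k < t, J k s = j k} ∩ {s | ∀ i < n, z i s = x i}) := by
  set A := {s | ∀ k < t, J k s = j k} with hA
  set B := {s | ∀ i < n, z i s = x i} with hB
  set L := Nat.log 2 T
  have hzm : Measurable fun s => fun i => z i s := measurable_pi_lambda _ hz.measurable
  have hbm := measurable_batchGrad_shift gradf w n
  set m := meanGrad μ gradf w
  set b : ℕ → S → E := fun l s => batchGrad gradf w (fun i => z (n + i) s) l with hb
  have hbmeas : ∀ l, Measurable (b l) := fun l => (hbm l).comp hzm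
  have hbG : ∀ l s, ‖b l s‖ ≤ G := fun l s => norm_batchGrad_le hG _ l
  have hmG : ‖m‖ ≤ G := norm_meanGrad_le hμ.prob hG
  have hnorm : ∀ l s, ‖m - b l s‖ ≤ 2 * G := fun l s => by
    have := norm_sub_le m (b l s)
    linarith [hbG l s]
  have hint : ∀ (l : ℕ) (ν : Measure S) [IsFiniteMeasure ν],
      Integrable (fun s => inner ℝ (m - b l s) v) ν := fun l ν _ => by
    refine Integrable.of_bound (((hbmeas l).const_sub m).inner measurable_const).aestronglyMeasurable
      (2 * G * ‖v‖) (Filter.Eventually.of_forall fun s => ?_)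
    refine (norm_inner_le_norm _ _).trans ?_
    gcongr
    exact hnorm l s
  have hsucc : ∀ i s, inner ℝ (b (i + 1) s - b i s) v =
      inner ℝ (m - b i s) v - inner ℝ (m - b (i + 1) s) v := fun i s => by
    rw [← inner_sub_left]
    congr 1
    abel
  have hintd : ∀ (i : ℕ) (ν : Measure S) [IsFiniteMeasure ν],
      Integrable (fun s => inner ℝ (b (i + 1) s - b i s) v) ν := fun i ν _ => by
    simp only [hsucc]
    exact (hint i ν).sub (hint (i + 1) ν)
  set d : ℕ → ℝ := fun l => ∫ s in B, inner ℝ (m - b l s) v ∂Pr with hd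
  have hlevel : ∀ i, ∫ s in A ∩ B, (if J t s = i + 1 then
      2 ^ (i + 1) * inner ℝ (b (i + 1) s - b i s) v else 0) ∂Pr =
      Pr.real A * (d i - d (i + 1)) := fun i => by
    have h := setIntegral_past_ite hz hJ hind j t x n (l := i + 1)
      (φ := fun y => 2 ^ (i + 1) * inner ℝ (batchGrad gradf w (fun k => y (n + k)) (i + 1) -
        batchGrad gradf w (fun k => y (n + k)) i) v)
      ((((hbm _).sub (hbm _)).inner measurable_const).const_mul _) (by omega)
    rw [h, integral_const_mul, ← mul_assoc ((1 / 2 : ℝ) ^ (i + 1)), ← mul_pow]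
    have e : ∫ s in B, inner ℝ (b (i + 1) s - b i s) v ∂Pr = d i - d (i + 1) := by
      simp only [hsucc]
      exact integral_sub (hint i _) (hint (i + 1) _)
    rw [← e]
    norm_num
    rfl
  have hintl : ∀ i, Integrable (fun s => if J t s = i + 1 then
      2 ^ (i + 1) * inner ℝ (b (i + 1) s - b i s) v else 0) (Pr.restrict (A ∩ B)) := fun i => by
    have := ((hintd i (Pr.restrict (A ∩ B))).const_mul (2 ^ (i + 1))).indicator
      (hJ.measurable t (measurableSet_singleton (i + 1)))
    refine this.congr (Filter.Eventually.of_forall fun s => ?_)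
    simp [Set.indicator]
  have hpt : ∀ s, inner ℝ (m - mlmcGrad T gradf w (fun i => z (n + i) s) (J t s)) v =
      inner ℝ (m - b 0 s) v - ∑ i ∈ Finset.range L, if J t s = i + 1 then
        2 ^ (i + 1) * inner ℝ (b (i + 1) s - b i s) v else 0 := fun s => by
    rw [mlmcGrad_eq_add_sum hT, ← sub_sub, inner_sub_left, sum_inner]
    congr 1
    refine Finset.sum_congr rfl fun i _ => ?_
    split_ifs
    · rw [real_inner_smul_left]
    · rw [inner_zero_left]
  have hmean : ∫ s in A ∩ B,
      inner ℝ (m - mlmcGrad T gradf w (fun i => z (n + i) s) (J t s)) v ∂Pr =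
      Pr.real A * d L := by
    simp only [hpt]
    rw [integral_sub (hint 0 _) (integrable_finsetSum _ fun i _ => hintl i),
      integral_finsetSum _ fun i _ => hintl i, Finset.sum_congr rfl fun i _ => hlevel i,
      ← Finset.mul_sum, Finset.sum_range_sub']
    have h0 := setIntegral_past hz hJ hind j t x n
      (φ := fun y => inner ℝ (m - batchGrad gradf w (fun k => y (n + k)) 0) v)
      (((hbm 0).const_sub m).inner measurable_const)
    rw [h0]
    simp only [hd]
    ring
  set V := 16 * G ^ 2 * (tauMix P μ : ℝ)
  have hτ : (0 : ℝ) < tauMix P μ := by exact_mod_cast (tauMix_spec hP hμ).1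
  set r := √(V / 2 ^ L)
  have hV : 0 < V / 2 ^ L := by positivity
  have hr : 0 < r := Real.sqrt_pos.2 hV
  have hr2 : r ^ 2 = V / 2 ^ L := Real.sq_sqrt hV.le
  have hvar : ∫ s in B, ‖b L s - m‖ ^ 2 ∂Pr ≤ r ^ 2 * Pr.real B := by
    have := (hz.restrict_shift n x).integral_batchGrad_sub_sq_le hP hμ hG L
    rwa [measureReal_restrict_apply_univ, ← hr2] at this
  have hintsq : Integrable (fun s => ‖b L s - m‖ ^ 2) (Pr.restrict B) := by
    refine Integrable.of_bound (((hbmeas _).sub_const _).norm.pow_const 2).aestronglyMeasurable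
      ((2 * G) ^ 2) (Filter.Eventually.of_forall fun s => ?_)
    rw [Real.norm_of_nonneg (by positivity), norm_sub_rev]
    gcongr
    exact hnorm L s
  have hdL : d L ≤ ‖v‖ * r * Pr.real B := by
    -- The Cauchy–Schwarz step `E y ≤ √(E y²)`, through `2 y ≤ r + y² / r`.
    calc d L ≤ ∫ s in B, ‖v‖ * ((r + ‖b L s - m‖ ^ 2 / r) / 2) ∂Pr := by
          refine integral_mono (hint L _)
            ((((integrable_const r).add (hintsq.div_const r)).div_const 2).const_mul _) fun s => ?_
          refine (real_inner_le_norm _ _).trans ?_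
          rw [mul_comm, norm_sub_rev]
          refine mul_le_mul_of_nonneg_left ?_ (norm_nonneg _)
          rw [le_div_iff₀ two_pos, ← sub_le_iff_le_add', le_div_iff₀ hr]
          nlinarith [sq_nonneg (‖b L s - m‖ - r)]
      _ = ‖v‖ * ((r * Pr.real B + (∫ s in B, ‖b L s - m‖ ^ 2 ∂Pr) / r) / 2) := by
          rw [integral_const_mul, integral_div, integral_add (integrable_const r)
            (hintsq.div_const r), integral_div]
          simp [mul_comm]
      _ ≤ ‖v‖ * ((r * Pr.real B + r ^ 2 * Pr.real B / r) / 2) := by gcongr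
      _ = ‖v‖ * r * Pr.real B := by
          field_simp
          ring
  rw [hmean, real_past hz hJ hind]
  calc Pr.real A * d L ≤ Pr.real A * (‖v‖ * r * Pr.real B) := by gcongr
    _ = ‖v‖ * r * (Pr.real A * Pr.real B) := by ring

end OneStep

/-! ### The run of the algorithm -/

section Run

variable {S Ω : Type*} [MeasurableSpace S] {Pr : Measure S} [IsProbabilityMeasure Pr]
  [MeasurableSpace Ω] [MeasurableSingletonClass Ω] {P : Matrix Ω Ω ℝ} {z : ℕ → S → Ω}
  {J : ℕ → S → ℕ}

/-- A bounded function of finitely many samples and levels is integrable; no regularity is needed,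
as these take countably many values. -/
lemma integrable_of_local [Finite Ω] [Nonempty Ω] (hz : IsMarkovChain Pr P z)
    (hJ : IsGeomLevels Pr J) {Φ : (ℕ → Ω) → (ℕ → ℕ) → ℝ} {M N : ℕ}
    (hloc : ∀ x x' j j', (∀ i < M, x i = x' i) → (∀ k < N, j k = j' k) → Φ x j = Φ x' j')
    {c : ℝ} (hc : ∀ x j, |Φ x j| ≤ c) :
    Integrable (fun s => Φ (fun i => z i s) fun k => J k s) Pr := by
  obtain ⟨x₀⟩ := ‹Nonempty Ω›
  let φ : (Fin M → Ω) × (Fin N → ℕ) → ℝ := fun p =>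
    Φ (fun i => if h : i < M then p.1 ⟨i, h⟩ else x₀) fun k => if h : k < N then p.2 ⟨k, h⟩ else 0
  have hm : Measurable fun s => ((fun i : Fin M => z i s), fun k : Fin N => J k s) :=
    (hz.measurable_prefix M).prodMk (measurable_pi_lambda _ fun k => hJ.measurable k)
  have h := integrable_comp_of_countable (ν := Pr) hm φ (c := c) fun s => hc _ _
  refine h.congr (Filter.Eventually.of_forall fun s => hloc _ _ _ _ (fun i hi => ?_) fun k hk => ?_)
  · simp [hi]
  · simp [hk]

/-- The expected number of samples per iteration is at most `1 + log₂ T`. -/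
lemma integral_numSamples_le (hJ : IsGeomLevels Pr J) {T : ℕ} (hT : 1 ≤ T) (t : ℕ) :
    ∫ s, (numSamples T (J t s) : ℝ) ∂Pr ≤ 1 + Nat.log 2 T := by
  have hm : ∀ l, MeasurableSet {s | J t s = l} := fun l =>
    hJ.measurable t (measurableSet_singleton l)
  have e : ∀ i s, (if J t s = i + 1 then (2 : ℝ) ^ (i + 1) else 0) =
      {s | J t s = i + 1}.indicator (fun _ => (2 : ℝ) ^ (i + 1)) s := fun i s => by
    simp [Set.indicator]
  have hint : ∀ i, Integrable (fun s => if J t s = i + 1 then (2 : ℝ) ^ (i + 1) else 0) Pr :=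
    fun i => by
      simp only [e]
      exact (integrable_const _).indicator (hm _)
  have hval : ∀ i, ∫ s, (if J t s = i + 1 then (2 : ℝ) ^ (i + 1) else 0) ∂Pr = 1 := fun i => by
    simp only [e]
    rw [integral_indicator_const _ (hm _), hJ.law t (i + 1) (by omega), smul_eq_mul, ← mul_pow]
    norm_num
  calc ∫ s, (numSamples T (J t s) : ℝ) ∂Pr
      ≤ ∫ s, (1 + ∑ i ∈ Finset.range (Nat.log 2 T),
          if J t s = i + 1 then (2 : ℝ) ^ (i + 1) else 0) ∂Pr :=
        integral_mono_of_nonneg (Filter.Eventually.of_forall fun s => by positivity)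
          ((integrable_const _).add (integrable_finsetSum _ fun i _ => hint i))
          (Filter.Eventually.of_forall fun s => numSamples_le_add_sum hT _)
    _ = 1 + Nat.log 2 T := by
        rw [integral_add (integrable_const _) (integrable_finsetSum _ fun i _ => hint i),
          integral_finsetSum _ fun i _ => hint i]
        simp [hval]

lemma integrable_numSamples (hJ : IsGeomLevels Pr J) {T : ℕ} (hT : 1 ≤ T) (t : ℕ) :
    Integrable (fun s => (numSamples T (J t s) : ℝ)) Pr :=
  integrable_comp_of_countable (hJ.measurable t) (fun j => (numSamples T j : ℝ)) (c := T) fun s => by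
    rw [abs_of_nonneg (by positivity)]
    exact_mod_cast numSamples_le hT _

variable [Fintype Ω] [DecidableEq Ω] {E : Type*} [NormedAddCommGroup E] [InnerProductSpace ℝ E]
  [ProperSpace E] [MeasurableSpace E] [BorelSpace E] [SecondCountableTopology E] {K : Set E}
  {gradf : E → Ω → E} {w₁ : E} {G : ℝ} {T : ℕ} {μ : Ω → ℝ}

/-- Unconditional second moment of the gradient estimates, from the conditional one: on a cell of
the past the current iterate is a constant. -/
lemma integral_norm_gradEst_sq_le (hP : IsErgodic P) (hμ : IsStationary P μ)
    (hz : IsMarkovChain Pr P z) (hJ : IsGeomLevels Pr J)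
    (hind : IndepFun (fun s n => z n s) (fun s t => J t s) Pr) (hK : IsClosed K) (hw : w₁ ∈ K)
    (hG : ∀ w ∈ K, ∀ x, ‖gradf w x‖ ≤ G) (hT : 1 ≤ T) (α : ℝ) (t : ℕ) :
    Integrable (fun s => ‖gradEst K α T gradf w₁ (fun i => z i s) (fun k => J k s) t‖ ^ 2) Pr ∧
    ∫ s, ‖gradEst K α T gradf w₁ (fun i => z i s) (fun k => J k s) t‖ ^ 2 ∂Pr ≤
      2 * G ^ 2 + 192 * Nat.log 2 T * (G ^ 2 * tauMix P μ) := by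
  have := hμ.nonempty
  have hint : Integrable
      (fun s => ‖gradEst K α T gradf w₁ (fun i => z i s) (fun k => J k s) t‖ ^ 2) Pr := by
    refine integrable_of_local (M := (t + 1) * T) (N := t + 1)
      (Φ := fun x j => ‖gradEst K α T gradf w₁ x j t‖ ^ 2) (c := (G + T * (2 * G)) ^ 2) hz hJ
      (fun x x' j j' hx hj => ?_) fun x j => ?_
    · rw [gradEst_congr hj fun i hi => hx i (hi.trans_le (totalSamples_le hT _ _))]
    · rw [abs_of_nonneg (by positivity)]
      exact pow_le_pow_left₀ (norm_nonneg _)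
        (norm_mlmcGrad_le (hG _ (state_mem hK hw t)) _ _) 2
  refine ⟨hint, integral_le_of_past hz hJ hint T t fun j x => ?_⟩
  have hwK : (state K α T gradf w₁ x j t).1 ∈ K := state_mem hK hw t
  refine le_of_eq_of_le ?_ (setIntegral_norm_mlmcGrad_sq_le hP hμ hz hJ hind
    (hG _ hwK) hT j t x (totalSamples T j t))
  refine setIntegral_congr_fun ((hJ.measurableSet_lt j t).inter (hz.measurableSet_lt x _))
    fun s hs => ?_
  have h1 : totalSamples T (fun k => J k s) t = totalSamples T j t := totalSamples_congr hs.1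
  have h2 := state_congr (K := K) (α := α) (T := T) (gradf := gradf) (w₁ := w₁)
    (z := fun i => z i s) (z' := x) (J := fun k => J k s) (J' := j) (t := t) hs.1
    fun i hi => hs.2 i (h1 ▸ hi)
  simp only [gradEst, h2, h1]

/-- Unconditional bias of the gradient estimates against the direction to a comparison point. -/
lemma integral_inner_meanGrad_sub_gradEst_le (hP : IsErgodic P) (hμ : IsStationary P μ)
    (hz : IsMarkovChain Pr P z) (hJ : IsGeomLevels Pr J)
    (hind : IndepFun (fun s n => z n s) (fun s t => J t s) Pr) (hK : IsClosed K) (hw : w₁ ∈ K)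
    (hG0 : 0 < G) (hG : ∀ w ∈ K, ∀ x, ‖gradf w x‖ ≤ G) (hT : 1 ≤ T) (α : ℝ) {D : ℝ}
    (hD : ∀ x ∈ K, ∀ y ∈ K, ‖x - y‖ ≤ D) {u : E} (hu : u ∈ K) (t : ℕ) :
    Integrable (fun s => inner ℝ
        (meanGrad μ gradf (state K α T gradf w₁ (fun i => z i s) (fun k => J k s) t).1 -
          gradEst K α T gradf w₁ (fun i => z i s) (fun k => J k s) t)
        ((state K α T gradf w₁ (fun i => z i s) (fun k => J k s) t).1 - u)) Pr ∧
    ∫ s, inner ℝ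
        (meanGrad μ gradf (state K α T gradf w₁ (fun i => z i s) (fun k => J k s) t).1 -
          gradEst K α T gradf w₁ (fun i => z i s) (fun k => J k s) t)
        ((state K α T gradf w₁ (fun i => z i s) (fun k => J k s) t).1 - u) ∂Pr ≤
      D * √(16 * G ^ 2 * tauMix P μ / 2 ^ Nat.log 2 T) := by
  have := hμ.nonempty
  have hint : Integrable (fun s => inner ℝ
        (meanGrad μ gradf (state K α T gradf w₁ (fun i => z i s) (fun k => J k s) t).1 -
          gradEst K α T gradf w₁ (fun i => z i s) (fun k => J k s) t)
        ((state K α T gradf w₁ (fun i => z i s) (fun k => J k s) t).1 - u)) Pr := by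
    refine integrable_of_local (M := (t + 1) * T) (N := t + 1)
      (Φ := fun x j => inner ℝ (meanGrad μ gradf (state K α T gradf w₁ x j t).1 -
        gradEst K α T gradf w₁ x j t) ((state K α T gradf w₁ x j t).1 - u))
      (c := (G + (G + T * (2 * G))) * D) hz hJ
      (fun x x' j j' hx hj => ?_) fun x j => ?_
    · have hx' : ∀ i < totalSamples T j (t + 1), x i = x' i := fun i hi =>
        hx i (hi.trans_le (totalSamples_le hT _ _))
      rw [gradEst_congr hj hx', state_congr (fun k hk => hj k (by omega)) fun i hi =>
        hx' i (by rw [totalSamples_succ]; omega)]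
    · have hwK : (state K α T gradf w₁ x j t).1 ∈ K := state_mem hK hw t
      refine (abs_real_inner_le_norm _ _).trans ?_
      refine mul_le_mul ((norm_sub_le _ _).trans (add_le_add (norm_meanGrad_le hμ.prob (hG _ hwK))
        (norm_mlmcGrad_le (hG _ hwK) _ _))) (hD _ hwK u hu) (norm_nonneg _) (by positivity)
  refine ⟨hint, integral_le_of_past hz hJ hint T t fun j x => ?_⟩
  have hwK : (state K α T gradf w₁ x j t).1 ∈ K := state_mem hK hw t
  refine le_trans (le_of_eq ?_) ((setIntegral_inner_meanGrad_sub_mlmcGrad_le hP hμ hz hJ hind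
    hG0 (hG _ hwK) hT j t x (totalSamples T j t)
    ((state K α T gradf w₁ x j t).1 - u)).trans ?_)
  · refine setIntegral_congr_fun ((hJ.measurableSet_lt j t).inter (hz.measurableSet_lt x _))
      fun s hs => ?_
    have h1 : totalSamples T (fun k => J k s) t = totalSamples T j t := totalSamples_congr hs.1
    have h2 := state_congr (K := K) (α := α) (T := T) (gradf := gradf) (w₁ := w₁)
      (z := fun i => z i s) (z' := x) (J := fun k => J k s) (J' := j) (t := t) hs.1
      fun i hi => hs.2 i (h1 ▸ hi)
    simp only [gradEst, h2, h1]
  · have := hD _ hwK u hu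
    gcongr

/-- The convergence rate before constants are collected. -/
lemma integral_objective_output_sub_le (hP : IsErgodic P) (hμ : IsStationary P μ)
    (hz : IsMarkovChain Pr P z) (hJ : IsGeomLevels Pr J)
    (hind : IndepFun (fun s n => z n s) (fun s t => J t s) Pr) (hK : IsClosed K) (hw : w₁ ∈ K)
    (hG0 : 0 < G) (hG : ∀ w ∈ K, ∀ x, ‖gradf w x‖ ≤ G) (hT : 1 ≤ T) {D : ℝ}
    (hD : ∀ x ∈ K, ∀ y ∈ K, ‖x - y‖ ≤ D) {f : E → Ω → ℝ}
    (hf : ∀ w ∈ K, ∀ x, HasGradientWithinAt (fun v => f v x) (gradf w x) K w)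
    (hF : ConvexOn ℝ K (objective μ f)) {u : E} (hu : u ∈ K)
    (hmin : IsMinOn (objective μ f) K u) :
    Integrable (fun s => objective μ f
      (output K (D / √2) T gradf w₁ (fun n => z n s) (fun t => J t s)) - objective μ f u) Pr ∧
    ∫ s, (objective μ f (output K (D / √2) T gradf w₁ (fun n => z n s) (fun t => J t s)) -
      objective μ f u) ∂Pr ≤
      √2 * D * √((2 * G ^ 2 + 192 * Nat.log 2 T * (G ^ 2 * tauMix P μ)) / T) +
        D * √(16 * G ^ 2 * tauMix P μ / 2 ^ Nat.log 2 T) := by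
  have := hμ.nonempty
  have hD0 : 0 ≤ D := by simpa using hD u hu u hu
  have hT0 : (0 : ℝ) < T := by exact_mod_cast hT
  have hint : Integrable (fun s => objective μ f
      (output K (D / √2) T gradf w₁ (fun n => z n s) (fun t => J t s)) - objective μ f u) Pr := by
    refine integrable_of_local (M := T * T) (N := T)
      (Φ := fun x j => objective μ f (output K (D / √2) T gradf w₁ x j) - objective μ f u)
      (c := G * D) hz hJ (fun x x' j j' hx hj => ?_) fun x j => ?_
    · have : output K (D / √2) T gradf w₁ x j = output K (D / √2) T gradf w₁ x' j' := by
        rw [output, output]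
        congr 1
        refine Finset.sum_congr rfl fun t ht => ?_
        have ht' := Finset.mem_range.1 ht
        rw [state_congr (fun k hk => hj k (by omega)) fun i hi => hx i
          (hi.trans_le ((totalSamples_le hT _ _).trans (Nat.mul_le_mul_right T ht'.le)))]
      rw [this]
    · have hoK := (objective_output_sub_le hK hw hD hf hF hu hT x j).1
      rw [abs_of_nonneg (sub_nonneg.2 (hmin hoK))]
      refine (objective_sub_le_inner hf hF hoK hu).trans ((real_inner_le_norm _ _).trans ?_)
      exact mul_le_mul (norm_meanGrad_le hμ.prob (hG _ hoK)) (hD _ hoK u hu) (norm_nonneg _) hG0.le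
  refine ⟨hint, ?_⟩
  set g : ℕ → S → E := fun t s =>
    gradEst K (D / √2) T gradf w₁ (fun i => z i s) (fun k => J k s) t
  set b : ℕ → S → ℝ := fun t s => inner ℝ
    (meanGrad μ gradf (state K (D / √2) T gradf w₁ (fun i => z i s) (fun k => J k s) t).1 -
      gradEst K (D / √2) T gradf w₁ (fun i => z i s) (fun k => J k s) t)
    ((state K (D / √2) T gradf w₁ (fun i => z i s) (fun k => J k s) t).1 - u)
  set V := 2 * G ^ 2 + 192 * Nat.log 2 T * (G ^ 2 * (tauMix P μ : ℝ))
  set β := √(16 * G ^ 2 * (tauMix P μ : ℝ) / 2 ^ Nat.log 2 T)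
  have hg : ∀ t, Integrable (fun s => ‖g t s‖ ^ 2) Pr ∧ ∫ s, ‖g t s‖ ^ 2 ∂Pr ≤ V :=
    integral_norm_gradEst_sq_le hP hμ hz hJ hind hK hw hG hT (D / √2)
  have hb : ∀ t, Integrable (b t) Pr ∧ ∫ s, b t s ∂Pr ≤ D * β :=
    integral_inner_meanGrad_sub_gradEst_le hP hμ hz hJ hind hK hw hG0 hG hT (D / √2) hD hu
  have hV : 0 < V := by positivity
  set r := √(T * V) with hr
  have hr0 : 0 < r := Real.sqrt_pos.2 (by positivity)
  have hr2 : r ^ 2 = T * V := Real.sq_sqrt (by positivity)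
  have hgint : Integrable (fun s => ∑ t ∈ Finset.range T, ‖g t s‖ ^ 2) Pr :=
    integrable_finsetSum _ fun t _ => (hg t).1
  have hbint : Integrable (fun s => ∑ t ∈ Finset.range T, b t s) Pr :=
    integrable_finsetSum _ fun t _ => (hb t).1
  have hgsum : ∫ s, ∑ t ∈ Finset.range T, ‖g t s‖ ^ 2 ∂Pr ≤ T * V := by
    rw [integral_finsetSum _ fun t _ => (hg t).1]
    simpa using Finset.sum_le_sum fun t (_ : t ∈ Finset.range T) => (hg t).2
  have hbsum : ∫ s, ∑ t ∈ Finset.range T, b t s ∂Pr ≤ T * (D * β) := by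
    rw [integral_finsetSum _ fun t _ => (hb t).1]
    simpa using Finset.sum_le_sum fun t (_ : t ∈ Finset.range T) => (hb t).2
  have hRint : Integrable (fun s => √2 * D *
      ((r + (∑ t ∈ Finset.range T, ‖g t s‖ ^ 2) / r) / 2)) Pr :=
    ((((integrable_const r).add (hgint.div_const r)).div_const 2).const_mul _)
  calc _ ≤ ∫ s, (T : ℝ)⁻¹ * (√2 * D * ((r + (∑ t ∈ Finset.range T, ‖g t s‖ ^ 2) / r) / 2) +
        ∑ t ∈ Finset.range T, b t s) ∂Pr := by
        refine integral_mono hint ((hRint.add hbint).const_mul _) fun s => ?_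
        refine (objective_output_sub_le hK hw hD hf hF hu hT _ _).2.trans ?_
        refine mul_le_mul_of_nonneg_left (add_le_add_left ?_ _) (by positivity)
        refine mul_le_mul_of_nonneg_left ?_ (by positivity)
        -- Concavity of the square root: it lies below its tangent at `T V`.
        have h0 : 0 ≤ ∑ t ∈ Finset.range T, ‖g t s‖ ^ 2 :=
          Finset.sum_nonneg fun _ _ => by positivity
        have h1 := Real.sq_sqrt h0
        rw [le_div_iff₀ two_pos, ← sub_le_iff_le_add', le_div_iff₀ hr0]
        nlinarith [sq_nonneg (√(∑ t ∈ Finset.range T, ‖g t s‖ ^ 2) - r)]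
    _ = (T : ℝ)⁻¹ * (√2 * D * ((r + (∫ s, ∑ t ∈ Finset.range T, ‖g t s‖ ^ 2 ∂Pr) / r) / 2) +
        ∫ s, ∑ t ∈ Finset.range T, b t s ∂Pr) := by
        rw [integral_const_mul, integral_add hRint hbint, integral_const_mul, integral_div,
          integral_add (integrable_const r) (hgint.div_const r), integral_div]
        simp
    _ ≤ (T : ℝ)⁻¹ * (√2 * D * ((r + T * V / r) / 2) + T * (D * β)) := by gcongr
    _ = √2 * D * (r / T) + D * β := by
        rw [← hr2]
        field_simp
        ring
    _ = √2 * D * √(V / T) + D * β := by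
        have : r / T = √(V / T) := by
          rw [eq_comm, Real.sqrt_eq_iff_mul_self_eq (by positivity) (by positivity), ← sq, div_pow,
            hr2]
          field_simp
        rw [this]

end Run

/-! ### Collecting the constants -/

lemma natLog_two_le {T : ℕ} (hT : 1 ≤ T) : (Nat.log 2 T : ℝ) ≤ 3 / 2 * Real.log T := by
  have h1 : (2 : ℝ) ^ Nat.log 2 T ≤ T := by
    exact_mod_cast Nat.pow_log_le_self 2 (by omega)
  have h2 := Real.log_le_log (by positivity) h1
  rw [Real.log_pow] at h2
  have := Real.log_two_gt_d9
  have h3 : (0 : ℝ) ≤ Nat.log 2 T := by positivity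
  nlinarith

lemma rate_le {T : ℕ} (hT : 1 ≤ T) {G D τ : ℝ} (hG : 0 < G) (hD : 0 ≤ D) (hτ : 1 ≤ τ) :
    √2 * D * √((2 * G ^ 2 + 192 * Nat.log 2 T * (G ^ 2 * τ)) / T) +
        D * √(16 * G ^ 2 * τ / 2 ^ Nat.log 2 T) ≤
      30 * (1 + Real.log T) ^ 1 * (G * D * √(τ / T)) := by
  have hT0 : (0 : ℝ) < T := by exact_mod_cast hT
  have hlog : 0 ≤ Real.log T := Real.log_nonneg (by exact_mod_cast hT)
  have hL := natLog_two_le hT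
  have hmain : √2 * √((2 * G ^ 2 + 192 * Nat.log 2 T * (G ^ 2 * τ)) / T) ≤
      24 * (1 + Real.log T) * G * √(τ / T) := by
    rw [← Real.sqrt_mul (by norm_num)]
    refine Real.sqrt_le_iff.2 ⟨by positivity, ?_⟩
    rw [mul_pow, Real.sq_sqrt (by positivity), ← mul_div_assoc, ← mul_div_assoc]
    refine div_le_div_of_nonneg_right ?_ hT0.le
    have h1 : G ^ 2 ≤ G ^ 2 * τ := le_mul_of_one_le_right (by positivity) hτ
    have h2 : (Nat.log 2 T : ℝ) * (G ^ 2 * τ) ≤ 3 / 2 * Real.log T * (G ^ 2 * τ) := by gcongr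
    have h3 : (1 + Real.log T) * (G ^ 2 * τ) ≤ (1 + Real.log T) ^ 2 * (G ^ 2 * τ) := by
      gcongr
      nlinarith
    nlinarith
  have hbias : √(16 * G ^ 2 * τ / 2 ^ Nat.log 2 T) ≤ 6 * G * √(τ / T) := by
    refine Real.sqrt_le_iff.2 ⟨by positivity, ?_⟩
    rw [mul_pow, Real.sq_sqrt (by positivity), ← mul_div_assoc,
      div_le_div_iff₀ (by positivity) hT0]
    have h1 : (T : ℝ) ≤ 2 ^ Nat.log 2 T * 2 := by
      have := (Nat.lt_pow_succ_log_self (b := 2) (by norm_num) T).le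
      rw [pow_succ] at this
      exact_mod_cast this
    have h2 : 16 * G ^ 2 * τ * T ≤ 16 * G ^ 2 * τ * (2 ^ Nat.log 2 T * 2) := by gcongr
    have h3 : 0 ≤ G ^ 2 * τ * 2 ^ Nat.log 2 T := by positivity
    nlinarith
  have h1 := mul_le_mul_of_nonneg_left hmain hD
  have h2 := mul_le_mul_of_nonneg_left hbias hD
  have h3 : 0 ≤ Real.log T * (D * G * √(τ / T)) := by positivity
  nlinarith

end MAG

theorem mainTheorem1 :
    ∃ (C : ℝ) (p : ℕ), 0 < C ∧
      ∀ {Ω : Type*} [Fintype Ω] [DecidableEq Ω] [MeasurableSpace Ω] [MeasurableSingletonClass Ω]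
        {S : Type*} [MeasurableSpace S] (Pr : Measure S) [IsProbabilityMeasure Pr]
        (P : Matrix Ω Ω ℝ) (μ : Ω → ℝ) (_ : MAG.IsErgodic P) (_ : MAG.IsStationary P μ)
        (z : ℕ → S → Ω) (_ : MAG.IsMarkovChain Pr P z)
        (J : ℕ → S → ℕ) (_ : MAG.IsGeomLevels Pr J)
        (_ : IndepFun (fun s n => z n s) (fun s t => J t s) Pr)
        (d : ℕ) (K : Set (EuclideanSpace ℝ (Fin d))) (_ : IsClosed K)
        (D : ℝ) (_ : ∀ x ∈ K, ∀ y ∈ K, ‖x - y‖ ≤ D)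
        (f : EuclideanSpace ℝ (Fin d) → Ω → ℝ)
        (gradf : EuclideanSpace ℝ (Fin d) → Ω → EuclideanSpace ℝ (Fin d))
        (_ : ∀ w ∈ K, ∀ x, HasGradientWithinAt (fun v => f v x) (gradf w x) K w)
        (G : ℝ) (_ : 0 < G) (_ : ∀ w ∈ K, ∀ x, ‖gradf w x‖ ≤ G)
        (_ : ConvexOn ℝ K (MAG.objective μ f))
        (w₁ : EuclideanSpace ℝ (Fin d)) (_ : w₁ ∈ K)
        (wstar : EuclideanSpace ℝ (Fin d)) (_ : wstar ∈ K)
        (_ : IsMinOn (MAG.objective μ f) K wstar)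
        (T : ℕ) (_ : 1 ≤ T),
        (Integrable (fun s =>
            MAG.objective μ f
                (MAG.output K (D / √2) T gradf w₁ (fun n => z n s) (fun t => J t s)) -
              MAG.objective μ f wstar) Pr ∧
          ∫ s, (MAG.objective μ f
                (MAG.output K (D / √2) T gradf w₁ (fun n => z n s) (fun t => J t s)) -
              MAG.objective μ f wstar) ∂Pr ≤
            C * (1 + Real.log T) ^ p * (G * D * √((MAG.tauMix P μ : ℝ) / T))) ∧
        (Integrable (fun s => (MAG.totalSamples T (fun t => J t s) T : ℝ)) Pr ∧
          ∫ s, (MAG.totalSamples T (fun t => J t s) T : ℝ) ∂Pr ≤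
            C * (1 + Real.log T) * T) := by
  refine ⟨30, 1, by norm_num, ?_⟩
  intro Ω _ _ _ _ S _ Pr _ P μ hP hμ z hz J hJ hind d K hK D hD f gradf hf G hG0 hG hF w₁ hw
    wstar hwstar hmin T hT
  have hD0 : 0 ≤ D := by simpa using hD _ hw _ hw
  refine ⟨?_, ?_⟩
  · obtain ⟨h1, h2⟩ := MAG.integral_objective_output_sub_le hP hμ hz hJ hind hK hw hG0 hG hT hD hf
      hF hwstar hmin
    refine ⟨h1, h2.trans (MAG.rate_le hT hG0 hD0 ?_)⟩
    exact_mod_cast (MAG.tauMix_spec hP hμ).1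
  · have hint := fun t => MAG.integrable_numSamples hJ hT t
    simp only [MAG.totalSamples, Nat.cast_sum]
    refine ⟨integrable_finsetSum _ fun t _ => hint t, ?_⟩
    rw [integral_finsetSum _ fun t _ => hint t]
    have hsum := Finset.sum_le_sum fun t (_ : t ∈ Finset.range T) =>
      MAG.integral_numSamples_le hJ hT t
    rw [Finset.sum_const, Finset.card_range, nsmul_eq_mul] at hsum
    refine hsum.trans ?_
    rw [mul_comm]
    refine mul_le_mul_of_nonneg_right ?_ (Nat.cast_nonneg T)
    have := MAG.natLog_two_le hT
    have hlog : 0 ≤ Real.log T := Real.log_nonneg (by exact_mod_cast hT)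
    linarith
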